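/- Fix an integer $m\ge 2$ and a real $\delta>0$. The preferential attachment multigraphs $G_n$, $n\ge 1$, are defined as follows. $G_1$ consists of the vertices $0,1$ and $m$ parallel edges between them. Given $G_n$, which has vertices $0,\dots,n$, the graph $G_{n+1}$ is obtained by adding the vertex $n+1$ and $m$ edges from it to vertices of $G_n$; the $m$ endpoints are drawn independently, each being equal to $i\in\{0,\dots,n\}$ with probability proportional to $\deg_{G_n}(i)+\delta$, that is, with probability $$\frac{\deg_{G_n}(i)+\delta}{(2m+\delta)n+\delta},$$ where degrees are counted with multiplicity. Put $\tau=3+\delta/m$. Let $H$ be a simple graph on $k$ vertices and let $\pi:V(H)\to\{1,\dots,k\}$ be a bijection. Let $N_n(H,\pi)$ be the number of subgraphs of the multigraph $G_n$ (parallel edges being regarded as different) that are isomorphic to $H$ through an isomorphism $\varphi$ with $\varphi(u)<\varphi(v)$ whenever $\pi(u)<\pi(v)$, and let $N_n'(H,\pi)$ be the number of such subgraphs of the simple graph underlying $G_n$ (parallel edges being identified). Put $$\beta_{H,\pi}(s)=-s-\sum_{i=s+1}^k\left(\frac{1}{\tau-1}\,d_H^{in}(\pi^{-1}(i))+\Big(1-\frac{1}{\tau-1}\Big)d_H^{out}(\pi^{-1}(i))\right),\qquad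 B(H,\pi)=\max_{s=0,1,\dots,k}\beta_{H,\pi}(s),$$ where $d_H^{in}(v)$ and $d_H^{out}(v)$ are the numbers of neighbours $u$ of $v$ in $H$ with $\pi(u)>\pi(v)$ and with $\pi(u)<\pi(v)$ respectively, and let $r(H,\pi)$ be the number of $s\in\{0,\dots,k\}$ that attain the maximum. Lemma. Let $k\ge 3$, let $H$ be a cycle on $k$ vertices and let $\pi:V(H)\to\{1,\dots,k\}$ be any bijection. Then $B(H,\pi)=-k$, the maximum is attained exactly at $s=0$ and $s=k$, and so $r(H,\pi)=2$. Moreover, there are constants $0<C_3\le C_4<\infty$ (depending on $H$, $\pi$, $m$ and $\delta$) such that, for all large enough $n$, $$C_3\ln n\le \mathbb{E}N_n(H,\pi)\le C_4\ln n\qquad\text{and}\qquad C_3\ln n\le \mathbb{E}N_n'(H,\pi)\le C_4\ln n .$$ -/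

import Mathlib

namespace PrefAttach

/-- A possible state of the preferential attachment multigraph `G_n` on the vertices `0, …, n`
with `m` edges per vertex. The vertex `i + 1` (where `i < n`) has the `m` edges `(i, 0), …, (i, m-1)`
to older vertices, and `G i j ∈ {0, …, i}` is the older endpoint of the edge `(i, j)`.
For `n = 1` the only state has the vertices `0`, `1` and `m` parallel edges between them. -/
abbrev State (m n : ℕ) : Type := (i : Fin n) → Fin m → Fin (i + 1)

/-- The multigraph described by a state. -/
def State.toGraph {m n : ℕ} (G : State m n) : Graph (Fin (n + 1)) (Fin n × Fin m) where
  vertexSet := Set.univ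
  edgeSet := Set.univ
  IsLink e x y :=
    (x = e.1.succ ∧ y = (G e.1 e.2).castLE (by omega)) ∨
      (y = e.1.succ ∧ x = (G e.1 e.2).castLE (by omega))
  isLink_symm e _ := ⟨fun x y h => h.symm⟩
  eq_or_eq_of_isLink_of_isLink := by
    rintro e x y v w (⟨h₁, h₂⟩ | ⟨h₁, h₂⟩) (⟨h₃, h₄⟩ | ⟨h₃, h₄⟩) <;> simp_all
  edge_mem_iff_exists_isLink e := ⟨fun _ => ⟨_, _, Or.inl ⟨rfl, rfl⟩⟩, fun _ => trivial⟩
  left_mem_of_isLink := fun _ _ _ _ => trivial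

/-- The degree of a vertex, counted with multiplicity (there are no loops). -/
noncomputable def State.degree {m n : ℕ} (G : State m n) (v : Fin (n + 1)) : ℕ :=
  (G.toGraph.incidenceSet v).ncard

open Classical in
theorem State.sum_degree {m n : ℕ} (G : State m n) : ∑ v, G.degree v = 2 * (m * n) := by
  have h : ∀ v, G.degree v = ∑ e : Fin n × Fin m, if G.toGraph.Inc e v then 1 else 0 := by
    intro v
    rw [Finset.sum_boole, Nat.cast_id, State.degree, ← Set.ncard_coe_finset]
    congr 1
    ext e
    simp [Graph.incidenceSet]
  simp only [h]
  rw [Finset.sum_comm]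
  have h2 : ∀ e : Fin n × Fin m, (∑ v, if G.toGraph.Inc e v then 1 else 0) = 2 := by
    intro e
    rw [Finset.sum_boole]
    have hne : e.1.succ ≠ (G e.1 e.2).castLE (by omega) := by
      intro h
      have h1 := congrArg Fin.val h
      have h2 := (G e.1 e.2).isLt
      simp at h1
      omega
    have : (Finset.univ.filter fun v => G.toGraph.Inc e v)
        = {e.1.succ, (G e.1 e.2).castLE (by omega)} := by
      ext v
      simp [Graph.Inc, State.toGraph, exists_or]
    rw [this, Finset.card_pair hne]
    rfl
  simp [h2]
  ring

/-- The law of the older endpoint of one new edge, given `G_n`: the vertex `v` is chosen with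
probability proportional to its degree plus `δ`. -/
noncomputable def edgeLaw {m n : ℕ} (δ : ℝ) (hδ : 0 < δ) (G : State m n) : PMF (Fin (n + 1)) :=
  PMF.ofFintype (fun v => ENNReal.ofReal ((G.degree v + δ) / ((2 * m + δ) * n + δ))) <| by
    have hpos : 0 < (2 * m + δ) * n + δ := by positivity
    rw [← ENNReal.ofReal_sum_of_nonneg (fun v _ => by positivity), ← Finset.sum_div,
      Finset.sum_add_distrib, ← Nat.cast_sum, G.sum_degree, ENNReal.ofReal_eq_one,
      div_eq_one_iff_eq hpos.ne']
    simp
    ring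

/-- The joint law of the older endpoints of the `m` new edges, given `G_n`: they are independent,
each with law `edgeLaw`. -/
noncomputable def stepLaw {m n : ℕ} (δ : ℝ) (hδ : 0 < δ) (G : State m n) :
    PMF (Fin m → Fin (n + 1)) :=
  PMF.ofFintype (fun c => ∏ j, edgeLaw δ hδ G (c j)) <| by
    have h : ∑ v, edgeLaw δ hδ G v = 1 := by
      rw [← tsum_fintype (L := SummationFilter.unconditional _)]
      exact (edgeLaw δ hδ G).tsum_coe
    have h' := Finset.prod_univ_sum (fun _ : Fin m => Finset.univ) fun _ v => edgeLaw δ hδ G v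
    rw [Fintype.piFinset_univ] at h'
    rw [← h']
    simp [h]

/-- The law of `G_n`. The recursion starts at the single vertex `0` with no edge; its first step
leads with probability one to `G_1`, the vertices `0`, `1` with `m` edges between them. -/
noncomputable def law (m : ℕ) (δ : ℝ) (hδ : 0 < δ) : (n : ℕ) → PMF (State m n)
  | 0 => PMF.pure fun i => i.elim0
  | n + 1 => (law m δ hδ n).bind fun G =>
      (stepLaw δ hδ G).map fun c =>
        Fin.snoc (α := fun i : Fin (n + 1) => Fin m → Fin (i + 1)) G c

/-- The expectation of a function of `G_n` (which takes finitely many values). -/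
noncomputable def expect (m : ℕ) (δ : ℝ) (hδ : 0 < δ) (n : ℕ) (X : State m n → ℝ) : ℝ :=
  ∑ G, (law m δ hδ n G).toReal * X G

section Counting

variable {V : Type*} {k m n : ℕ}

/-- The number of subgraphs of the multigraph `G_n` (parallel edges being different edges)
that are isomorphic to the simple graph `H` through an isomorphism carrying the ordering `π` to the
order of age in `G_n` (vertices with smaller labels are older). -/
noncomputable def copies (H : SimpleGraph V) (π : V ≃ Fin k) (G : State m n) : ℕ :=
  {S : Graph (Fin (n + 1)) (Fin n × Fin m) | S ≤ G.toGraph ∧ S.Simple ∧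
    ∃ e : H ≃g S.toSimpleGraph,
      ∀ u v, π u < π v → (e u : Fin (n + 1)) < (e v : Fin (n + 1))}.ncard

/-- The same number for the simple graph underlying `G_n`, i.e. parallel edges are identified. -/
noncomputable def simpleCopies (H : SimpleGraph V) (π : V ≃ Fin k) (G : State m n) : ℕ :=
  {S : G.toGraph.toSimpleGraph.Subgraph | ∃ e : H ≃g S.coe,
    ∀ u v, π u < π v → ((e u).1 : Fin (n + 1)) < ((e v).1 : Fin (n + 1))}.ncard

end Counting

section Exponent

variable {V : Type*} {k : ℕ}

/-- The exponent `τ` of the power law of the degree distribution. -/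
noncomputable def tau (m : ℕ) (δ : ℝ) : ℝ := 3 + δ / m

/-- The number of neighbours of `v` that are younger than `v`. -/
noncomputable def inDeg (H : SimpleGraph V) (π : V ≃ Fin k) (v : V) : ℕ :=
  {u | H.Adj v u ∧ π v < π u}.ncard

/-- The number of neighbours of `v` that are older than `v`. -/
noncomputable def outDeg (H : SimpleGraph V) (π : V ≃ Fin k) (v : V) : ℕ :=
  {u | H.Adj v u ∧ π u < π v}.ncard

/-- The expression maximised over `s = 0, …, k` in `B(H, π)`. The element `i` of `Fin k` stands for
the position `i + 1` in `{1, …, k}`, so the sum is over the positions `s + 1, …, k`. -/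
noncomputable def exponent (m : ℕ) (δ : ℝ) (H : SimpleGraph V) (π : V ≃ Fin k) (s : ℕ) : ℝ :=
  -(s : ℝ) - ∑ i : Fin k with s ≤ i.val,
    (1 / (tau m δ - 1) * inDeg H π (π.symm i) + (1 - 1 / (tau m δ - 1)) * outDeg H π (π.symm i))

/-- `B(H, π)`. -/
noncomputable def B (m : ℕ) (δ : ℝ) (H : SimpleGraph V) (π : V ≃ Fin k) : ℝ :=
  (Finset.range (k + 1)).sup' Finset.nonempty_range_add_one (exponent m δ H π)

open Classical in
/-- The set of the `s` that attain the maximum in `B(H, π)`; `r(H, π)` is its cardinality. -/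
noncomputable def optimizers (m : ℕ) (δ : ℝ) (H : SimpleGraph V) (π : V ≃ Fin k) : Finset ℕ :=
  (Finset.range (k + 1)).filter fun s => exponent m δ H π s = B m δ H π

/-- `r(H, π)`, the number of optimizers. -/
noncomputable def r (m : ℕ) (δ : ℝ) (H : SimpleGraph V) (π : V ≃ Fin k) : ℕ :=
  (optimizers m δ H π).card

end Exponent

end PrefAttach

/-! Write χ = 1/(τ − 1) = m/(2m + δ); since δ > 0, χ < 1/2. A copy of `H` is a strictly increasing
placement `f` of the `k` positions together with a label in `Fin m` for every edge. Up to constants,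
the probability that all these edges are present is at most the product over edges of (older
end)^(−χ) · (younger end)^(−(1−χ)) (`expect_meets_le`, `exists_edgeBound_le`). Edges to a common
vertex reinforce each other through its degree. This is controlled by a near-supermartingale: the
indicator of the edges prescribed so far, times rising factorials of degree + δ whose orders are the
numbers of prescribed edges still to arrive.

For a cut before position `s`, let I and O count the edges whose older, respectively younger, end
lies at or after the cut. A cycle is 2-regular, so I + O = 2(k − s); it is connected, so I < O for 0
< s < k. As χ < 1/2, the exponent χI + (1−χ)O of the tail exceeds k − s
(`lt_sum_vertexExponent_tail`), while for s = 0 it equals k. This gives the optimizers 0 and k. It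
also shows that, summing over placements from the youngest vertex to the oldest, every inner sum
converges and only Σ 1/v over the oldest vertex remains: one logarithm (`exists_sum_strictMono_le`).

For the lower bound, each draw hits a given vertex with probability at least δ over the total
weight. A placement with youngest vertex v thus has probability at least of order v^(−k). There are
of order v^(k−1) of them, and Σ 1/v appears again (`exists_le_sum_strictMono`). Here the labels are
fixed so that the at most two edges from a vertex to older ones differ, which needs m ≥ 2.

Both counts lie between the number of placements realised with these fixed labels (`embeddings`) and
the number of labelled placements (`labelledMaps`). -/

namespace PrefAttach

open Finset

/-! ### Rising factorials -/

/-- The rising factorial `x (x + 1) ⋯ (x + d - 1)`. -/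
noncomputable def rise (x : ℝ) (d : ℕ) : ℝ := ∏ i ∈ range d, (x + i)

theorem rise_zero (x : ℝ) : rise x 0 = 1 := by simp [rise]

theorem rise_succ (x : ℝ) (d : ℕ) : rise x (d + 1) = rise x d * (x + d) := by
  simp [rise, prod_range_succ]

/-- Both sides are `rise x (d + 1)`, with the first or the last factor split off. This describes the
effect of one new edge on a rising factorial of the degree. -/
theorem rise_add_one_mul (x : ℝ) (d : ℕ) : rise (x + 1) d * x = rise x d * (x + d) := by
  rw [← rise_succ, rise, rise, prod_range_succ']
  congr 1
  · refine prod_congr rfl fun i _ => ?_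
    push_cast
    ring
  · simp

theorem rise_nonneg {x : ℝ} (hx : 0 ≤ x) (d : ℕ) : 0 ≤ rise x d :=
  prod_nonneg fun _ _ => by positivity

theorem rise_le_pow {x : ℝ} (hx : 0 ≤ x) {d e : ℕ} (h : d ≤ e) : rise x d ≤ (x + e) ^ d := by
  rw [rise, ← card_range d, ← prod_const, card_range]
  refine prod_le_prod (fun i _ => by positivity) fun i hi => ?_
  have : (i : ℝ) ≤ e := by exact_mod_cast (mem_range.1 hi).le.trans h
  linarith

/-! ### Bounds for independent draws -/

section Draws

variable {ι : Type*} [Fintype ι] [DecidableEq ι]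

theorem prod_rise_add_single (y : ι → ℝ) (d : ι → ℕ) (c : ι) :
    (∏ a, rise (y a + if c = a then 1 else 0) (d a)) * y c
      = (∏ a, rise (y a) (d a)) * (y c + d c) := by
  rw [← mul_prod_erase univ _ (mem_univ c),
    ← mul_prod_erase univ (fun a => rise (y a) (d a)) (mem_univ c)]
  have h : ∏ a ∈ univ.erase c, rise (y a + if c = a then 1 else 0) (d a)
      = ∏ a ∈ univ.erase c, rise (y a) (d a) := by
    refine prod_congr rfl fun a ha => ?_
    rw [if_neg (ne_of_mem_erase ha).symm, add_zero]
  rw [h, if_pos rfl]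
  linear_combination (∏ a ∈ univ.erase c, rise (y a) (d a)) * rise_add_one_mul (y c) (d c)

/-- Drawing `c` multiplies the product by (y c + d c) / y c, which is at most (x c + d c) / x c
because x ≤ y. A free draw therefore costs (L + Σ d) / L, and a prescribed draw `s` costs 1 / L and
lengthens the rising factorial at `s`. The weights `x` are kept apart from `y` because all draws of
a step use the degrees in `G_n`, while the rising factorials already contain the earlier draws. -/
theorem sum_draw_le {x y : ι → ℝ} (hx : ∀ a, 0 < x a) (hxy : ∀ a, x a ≤ y a) {L : ℝ}
    (hL : ∑ a, x a = L) (hL0 : 0 < L) (S : Finset ι) (d : ι → ℕ) {D : ℝ}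
    (hD : ∑ a, (d a : ℝ) ≤ D) :
    ∑ c, x c / L * (if ∀ s ∈ S, c = s then 1 else 0) *
        ∏ a, rise (y a + if c = a then 1 else 0) (d a)
      ≤ (1 / L) ^ #S * (1 + D / L) * ∏ a, rise (y a) (d a + if a ∈ S then 1 else 0) := by
  have hy : ∀ a, 0 < y a := fun a => (hx a).trans_le (hxy a)
  have hP : ∀ e : ι → ℕ, 0 ≤ ∏ a, rise (y a) (e a) :=
    fun e => prod_nonneg fun a _ => rise_nonneg (hy a).le _
  have hD0 : 0 ≤ D := le_trans (by positivity) hD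
  have key : ∀ c, x c * ∏ a, rise (y a + if c = a then 1 else 0) (d a)
      ≤ (∏ a, rise (y a) (d a)) * (x c + d c) := by
    intro c
    have h := prod_rise_add_single y d c
    have hQ : (∏ a, rise (y a + if c = a then 1 else 0) (d a))
        = (∏ a, rise (y a) (d a)) * (y c + d c) / y c := by
      rw [← h, mul_div_cancel_right₀ _ (hy c).ne']
    rw [hQ, mul_div_assoc, mul_left_comm]
    refine mul_le_mul_of_nonneg_left ?_ (hP d)
    rw [← mul_div_assoc, div_le_iff₀ (hy c)]
    have := mul_le_mul_of_nonneg_right (hxy c) (Nat.cast_nonneg (α := ℝ) (d c))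
    nlinarith
  rcases S.eq_empty_or_nonempty with rfl | ⟨s, hs⟩
  · simp only [notMem_empty, false_imp_iff, implies_true, if_true, mul_one, card_empty, pow_zero,
      one_mul, if_false, add_zero]
    calc ∑ c, x c / L * ∏ a, rise (y a + if c = a then 1 else 0) (d a)
        = (∑ c, x c * ∏ a, rise (y a + if c = a then 1 else 0) (d a)) / L := by
          rw [sum_div]
          exact sum_congr rfl fun c _ => by ring
      _ ≤ (∑ c, (∏ a, rise (y a) (d a)) * (x c + d c)) / L := by
          exact div_le_div_of_nonneg_right (sum_le_sum fun c _ => key c) hL0.le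
      _ = (1 + (∑ a, (d a : ℝ)) / L) * ∏ a, rise (y a) (d a) := by
          rw [← mul_sum, sum_add_distrib, hL]
          field_simp
      _ ≤ _ := by
          refine mul_le_mul_of_nonneg_right ?_ (hP d)
          gcongr
  by_cases h1 : S = {s}
  · subst h1
    have hsum : ∀ c, x c / L * (if ∀ t ∈ ({s} : Finset ι), c = t then 1 else 0) *
        ∏ a, rise (y a + if c = a then 1 else 0) (d a) = if c = s then x c / L *
        ∏ a, rise (y a + if c = a then 1 else 0) (d a) else 0 := by
      intro c
      by_cases hc : c = s <;> simp [hc]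
    rw [sum_congr rfl fun c _ => hsum c, sum_ite_eq' univ s, if_pos (mem_univ s), card_singleton,
      pow_one]
    have hprod : ∏ a, rise (y a) (d a + if a ∈ ({s} : Finset ι) then 1 else 0)
        = (∏ a, rise (y a) (d a)) * (y s + d s) := by
      rw [← mul_prod_erase univ _ (mem_univ s),
        ← mul_prod_erase univ (fun a => rise (y a) (d a)) (mem_univ s), if_pos (mem_singleton_self s),
        rise_succ, mul_right_comm]
      congr 2
      refine prod_congr rfl fun a ha => ?_
      rw [if_neg (by simpa using ne_of_mem_erase ha), add_zero]
    rw [hprod]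
    calc x s / L * ∏ a, rise (y a + if s = a then 1 else 0) (d a)
        = 1 / L * (x s * ∏ a, rise (y a + if s = a then 1 else 0) (d a)) := by ring
      _ ≤ 1 / L * ((∏ a, rise (y a) (d a)) * (x s + d s)) := by
          exact mul_le_mul_of_nonneg_left (key s) (by positivity)
      _ ≤ 1 / L * ((∏ a, rise (y a) (d a)) * (y s + d s)) := by
          have := hP d
          gcongr
          exact hxy s
      _ ≤ 1 / L * (1 + D / L) * ((∏ a, rise (y a) (d a)) * (y s + d s)) := by
          have h0 : 0 ≤ (∏ a, rise (y a) (d a)) * (y s + d s) :=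
            mul_nonneg (hP d) (by have := hy s; positivity)
          refine mul_le_mul_of_nonneg_right ?_ h0
          refine le_mul_of_one_le_right (by positivity) ?_
          have : 0 ≤ D / L := by positivity
          linarith
  -- Two different prescribed values exclude each other, so the left side vanishes.
  · have h0 : ∀ c, ¬ ∀ t ∈ S, c = t := by
      intro c hc
      refine h1 (eq_singleton_iff_unique_mem.2 ⟨hs, fun t ht => ?_⟩)
      rw [← hc t ht, hc s hs]
    simp only [h0, if_false, mul_zero, zero_mul, sum_const_zero]
    have := hP fun a => d a + if a ∈ S then 1 else 0
    positivity

/-- Induction on the number of draws: the later draws are summed first, with `y` raised by the first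
one, and their targets then count as pending for the first draw. `D` bounds all of these orders at
once, so the same factor serves every draw. -/
theorem sum_draws_le {x : ι → ℝ} (hx : ∀ a, 0 < x a) {L : ℝ} (hL : ∑ a, x a = L) (hL0 : 0 < L)
    {D : ℝ} (d : ι → ℕ) : ∀ (m : ℕ) {y : ι → ℝ} (_ : ∀ a, x a ≤ y a) (S : Fin m → Finset ι)
    (_ : ∑ a, ((d a + ∑ j, if a ∈ S j then 1 else 0 : ℕ) : ℝ) ≤ D),
    ∑ c : Fin m → ι, (∏ j, x (c j) / L * (if ∀ s ∈ S j, c j = s then 1 else 0)) *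
        ∏ a, rise (y a + ∑ j, if c j = a then 1 else 0) (d a)
      ≤ (∏ j, ((1 / L) ^ #(S j) * (1 + D / L))) *
        ∏ a, rise (y a) (d a + ∑ j, if a ∈ S j then 1 else 0)
  | 0, y, hxy, S, hD => by simp
  | m + 1, y, hxy, S, hD => by
    have hD' : ∑ a, ((d a + ∑ j : Fin m, if a ∈ S j.succ then 1 else 0 : ℕ) : ℝ) ≤ D := by
      refine le_trans (sum_le_sum fun a _ => ?_) hD
      rw [Nat.cast_le, Fin.sum_univ_succ]
      omega
    have hD0 : 0 ≤ D := le_trans (by positivity) hD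
    rw [← (Fin.consEquiv fun _ : Fin (m + 1) => ι).sum_comp, Fintype.sum_prod_type]
    simp only [Fin.consEquiv_apply, Fin.prod_univ_succ, Fin.sum_univ_succ, Fin.cons_zero,
      Fin.cons_succ]
    have step : ∀ c₀ : ι, ∑ c : Fin m → ι,
        (x c₀ / L * (if ∀ s ∈ S 0, c₀ = s then 1 else 0) *
          ∏ j, x (c j) / L * (if ∀ s ∈ S j.succ, c j = s then 1 else 0)) *
          ∏ a, rise (y a + ((if c₀ = a then 1 else 0) + ∑ j, if c j = a then 1 else 0)) (d a)
        ≤ (∏ j : Fin m, ((1 / L) ^ #(S j.succ) * (1 + D / L))) *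
          (x c₀ / L * (if ∀ s ∈ S 0, c₀ = s then 1 else 0) *
            ∏ a, rise (y a + if c₀ = a then 1 else 0)
              (d a + ∑ j : Fin m, if a ∈ S j.succ then 1 else 0)) := by
      intro c₀
      have ih := sum_draws_le hx hL hL0 d m (y := fun a => y a + if c₀ = a then 1 else 0)
        (fun a => (hxy a).trans (le_add_of_nonneg_right (by positivity))) (fun j => S j.succ) hD'
      have h0 : 0 ≤ x c₀ / L * (if ∀ s ∈ S 0, c₀ = s then (1 : ℝ) else 0) := by
        have := hx c₀
        positivity
      have := mul_le_mul_of_nonneg_left ih h0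
      rw [mul_sum] at this
      refine le_trans (le_of_eq (sum_congr rfl fun c _ => ?_)) (this.trans (le_of_eq ?_))
      · simp only [add_assoc, mul_assoc]
      · ring
    refine (sum_le_sum fun c₀ _ => step c₀).trans ?_
    rw [← mul_sum]
    have one := sum_draw_le hx hxy hL hL0 (S 0)
      (fun a => d a + ∑ j : Fin m, if a ∈ S j.succ then 1 else 0) hD'
    have h1 : 0 ≤ ∏ j : Fin m, ((1 / L) ^ #(S j.succ) * (1 + D / L)) :=
      prod_nonneg fun _ _ => by positivity
    refine (mul_le_mul_of_nonneg_left one h1).trans (le_of_eq ?_)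
    have : ∀ a, d a + ((if a ∈ S 0 then 1 else 0) + ∑ j : Fin m, if a ∈ S j.succ then 1 else 0)
        = (d a + ∑ j : Fin m, if a ∈ S j.succ then 1 else 0) + if a ∈ S 0 then 1 else 0 :=
      fun a => by omega
    simp only [this]
    ring

/-- By independence the sum factorises; a free draw contributes 1 and a prescribed one at least `q`.
-/
theorem le_sum_draws {p : ι → ℝ} (hp : ∑ a, p a = 1) {q : ℝ} (hq : ∀ a, q ≤ p a) {m : ℕ}
    (hq0 : 0 ≤ q) (S : Fin m → Finset ι) (hS : ∀ j, #(S j) ≤ 1) :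
    ∏ j, q ^ #(S j) ≤
      ∑ c : Fin m → ι, ∏ j, p (c j) * (if ∀ s ∈ S j, c j = s then 1 else 0) := by
  have h := prod_univ_sum (fun _ : Fin m => univ)
    fun j a => p a * (if ∀ s ∈ S j, a = s then (1 : ℝ) else 0)
  rw [Fintype.piFinset_univ] at h
  rw [← h]
  refine prod_le_prod (fun _ _ => by positivity) fun j _ => ?_
  rcases (S j).eq_empty_or_nonempty with h0 | ⟨s, hs⟩
  · simp [h0, hp]
  · have h1 : S j = {s} := eq_singleton_iff_unique_mem.2
      ⟨hs, fun t ht => card_le_one.1 (hS j) t ht s hs⟩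
    simp [h1, hq]

end Draws

end PrefAttach

namespace PrefAttach

open Finset

theorem prod_indicator {ι : Type*} [Fintype ι] (p : ι → Prop) [DecidablePred p]
    [Decidable (∀ i, p i)] :
    ∏ i, (if p i then (1 : ℝ) else 0) = if ∀ i, p i then 1 else 0 := by
  simp [prod_boole]

/-! ### The recursion for expectations -/

section Recursion

variable {m n : ℕ} {δ : ℝ}

/-- The state obtained by attaching a new vertex with the older endpoints `c`. -/
def State.extend (G : State m n) (c : Fin m → Fin (n + 1)) : State m (n + 1) :=
  Fin.snoc (α := fun i : Fin (n + 1) => Fin m → Fin (i + 1)) G c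

theorem State.extend_castSucc (G : State m n) (c : Fin m → Fin (n + 1)) (i : Fin n) :
    G.extend c i.castSucc = G i :=
  Fin.snoc_castSucc (α := fun i : Fin (n + 1) => Fin m → Fin (i + 1)) c G i

theorem State.extend_last (G : State m n) (c : Fin m → Fin (n + 1)) :
    G.extend c (Fin.last n) = c :=
  Fin.snoc_last (α := fun i : Fin (n + 1) => Fin m → Fin (i + 1)) c G

theorem State.degree_eq (G : State m n) (v : Fin (n + 1)) :
    G.degree v = ∑ i : Fin n, ∑ j, ((if (i : ℕ) + 1 = v then 1 else 0) +
      if (G i j : ℕ) = v then 1 else 0) := by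
  classical
  have h : G.degree v = ∑ e : Fin n × Fin m, if G.toGraph.Inc e v then 1 else 0 := by
    rw [Finset.sum_boole, Nat.cast_id, State.degree, ← Set.ncard_coe_finset]
    congr 1
    ext e
    simp [Graph.incidenceSet]
  rw [h, Fintype.sum_prod_type]
  refine sum_congr rfl fun i _ => sum_congr rfl fun j _ => ?_
  have hi : G.toGraph.Inc (i, j) v ↔ (i : ℕ) + 1 = v ∨ (G i j : ℕ) = v := by
    constructor
    · rintro ⟨y, ⟨h, -⟩ | ⟨-, h⟩⟩
      · exact .inl (congrArg Fin.val h).symm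
      · exact .inr (congrArg Fin.val h).symm
    · rintro (h | h)
      · exact ⟨_, .inl ⟨Fin.ext h.symm, rfl⟩⟩
      · exact ⟨_, .inr ⟨rfl, Fin.ext h.symm⟩⟩
  have := (G i j).isLt
  simp only [hi]
  split_ifs <;> omega

theorem State.degree_extend_castSucc (G : State m n) (c : Fin m → Fin (n + 1)) (v : Fin (n + 1)) :
    (G.extend c).degree v.castSucc = G.degree v + ∑ j, if c j = v then 1 else 0 := by
  rw [State.degree_eq, State.degree_eq, Fin.sum_univ_castSucc]
  congr 1
  · simp [State.extend_castSucc]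
  · refine sum_congr rfl fun j _ => ?_
    have := v.isLt
    rw [State.extend_last, if_neg (by simp; omega), zero_add]
    simp [Fin.ext_iff]

theorem State.degree_extend_last (G : State m n) (c : Fin m → Fin (n + 1)) :
    (G.extend c).degree (Fin.last (n + 1)) = m := by
  rw [State.degree_eq, Fin.sum_univ_castSucc]
  have h : ∀ i : Fin n, ∑ j : Fin m, ((if (i.castSucc : ℕ) + 1 = Fin.last (n + 1) then 1 else 0) +
      if (G.extend c i.castSucc j : ℕ) = Fin.last (n + 1) then 1 else 0) = 0 := by
    intro i
    refine sum_eq_zero fun j _ => ?_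
    have := i.isLt
    have := (G i j).isLt
    rw [State.extend_castSucc]
    simp
    omega
  have h' : ∀ j : Fin m, ((if (Fin.last n : ℕ) + 1 = Fin.last (n + 1) then 1 else 0) +
      if (G.extend c (Fin.last n) j : ℕ) = Fin.last (n + 1) then 1 else 0) = 1 := by
    intro j
    have := (c j).isLt
    rw [State.extend_last]
    simp
    omega
  rw [sum_congr rfl fun i _ => h i, sum_congr rfl fun j _ => h' j]
  simp

/-- The total weight `(2m + δ) n + δ` of the vertices of `G_n`. -/
noncomputable def totalWeight (m : ℕ) (δ : ℝ) (n : ℕ) : ℝ := (2 * m + δ) * n + δ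

theorem totalWeight_pos (hδ : 0 < δ) (m n : ℕ) : 0 < totalWeight m δ n := by
  unfold totalWeight
  positivity

theorem State.sum_weight (G : State m n) : ∑ v, ((G.degree v : ℝ) + δ) = totalWeight m δ n := by
  rw [Finset.sum_add_distrib, ← Nat.cast_sum, G.sum_degree, totalWeight]
  simp
  ring

theorem toReal_stepLaw (hδ : 0 < δ) (G : State m n) (c : Fin m → Fin (n + 1)) :
    (stepLaw δ hδ G c).toReal = ∏ j, ((G.degree (c j) : ℝ) + δ) / totalWeight m δ n := by
  rw [stepLaw, PMF.ofFintype_apply, ENNReal.toReal_prod]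
  refine prod_congr rfl fun j _ => ?_
  rw [edgeLaw, PMF.ofFintype_apply, ENNReal.toReal_ofReal (by positivity), totalWeight]

theorem expect_zero (hδ : 0 < δ) (X : State m 0 → ℝ) :
    expect m δ hδ 0 X = X fun i => i.elim0 := by
  have h : ∀ G : State m 0, G = fun i => i.elim0 := fun G => funext fun i => i.elim0
  rw [expect, Fintype.sum_eq_single (fun i => i.elim0) fun G hG => absurd (h G) hG]
  simp [law]

/-- Conditioning on `G_n`. Together with `expect_zero` this is how the law enters both probability
bounds. -/
theorem expect_succ (hδ : 0 < δ) (X : State m (n + 1) → ℝ) :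
    expect m δ hδ (n + 1) X = expect m δ hδ n fun G =>
      ∑ c : Fin m → Fin (n + 1),
        (∏ j, ((G.degree (c j) : ℝ) + δ) / totalWeight m δ n) * X (G.extend c) := by
  classical
  have h : ∀ G', (law m δ hδ (n + 1) G').toReal = ∑ G, (law m δ hδ n G).toReal *
      ∑ c, if G' = G.extend c then (stepLaw δ hδ G c).toReal else 0 := by
    intro G'
    rw [law, PMF.bind_apply, tsum_fintype, ENNReal.toReal_sum fun G _ =>
      ENNReal.mul_ne_top (PMF.apply_ne_top _ _) (PMF.apply_ne_top _ _)]
    refine sum_congr rfl fun G _ => ?_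
    rw [ENNReal.toReal_mul, PMF.map_apply, tsum_fintype, ENNReal.toReal_sum fun c _ => ?_]
    · congr 1
      refine sum_congr rfl fun c _ => ?_
      rw [State.extend]
      split_ifs <;> rfl
    · split_ifs
      · exact PMF.apply_ne_top _ _
      · exact ENNReal.zero_ne_top
  simp only [expect, h, sum_mul, mul_sum]
  rw [sum_comm]
  refine sum_congr rfl fun G _ => ?_
  rw [sum_comm]
  refine sum_congr rfl fun c _ => ?_
  rw [Fintype.sum_eq_single (G.extend c) fun G' hG' => by simp [hG'], if_pos rfl, toReal_stepLaw]
  ring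

theorem expect_mono (hδ : 0 < δ) {X Y : State m n → ℝ} (h : ∀ G, X G ≤ Y G) :
    expect m δ hδ n X ≤ expect m δ hδ n Y :=
  sum_le_sum fun G _ => mul_le_mul_of_nonneg_left (h G) ENNReal.toReal_nonneg

theorem expect_const_mul (hδ : 0 < δ) (a : ℝ) (X : State m n → ℝ) :
    expect m δ hδ n (fun G => a * X G) = a * expect m δ hδ n X := by
  rw [expect, expect, mul_sum]
  exact sum_congr rfl fun G _ => by ring

theorem expect_sum (hδ : 0 < δ) {ι : Type*} (s : Finset ι) (X : ι → State m n → ℝ) :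
    expect m δ hδ n (fun G => ∑ i ∈ s, X i G) = ∑ i ∈ s, expect m δ hδ n (X i) := by
  simp only [expect, mul_sum]
  exact sum_comm

end Recursion

/-! ### The probability that prescribed edges are present -/

section Requirements

variable {m n : ℕ} {δ : ℝ}

/-- Every triple `(i, j, a)` of `T` with `i < n` is an edge of the state: the edge `j` of the vertex
`i + 1` leads to `a`. -/
def State.Meets (T : Finset (ℕ × Fin m × ℕ)) (G : State m n) : Prop :=
  ∀ r ∈ T, ∀ i : Fin n, (i : ℕ) = r.1 → (G i r.2.1 : ℕ) = r.2.2

/-- The possible older endpoints of the edge `(n, j)` that are prescribed by `T`. -/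
def targets (T : Finset (ℕ × Fin m × ℕ)) (n : ℕ) (j : Fin m) : Finset (Fin (n + 1)) :=
  univ.filter fun a => (n, j, (a : ℕ)) ∈ T

/-- The number of edges to `v` that `T` prescribes after time `n`. -/
def pending (T : Finset (ℕ × Fin m × ℕ)) (n v : ℕ) : ℕ := #{r ∈ T | n ≤ r.1 ∧ r.2.2 = v}

variable {T : Finset (ℕ × Fin m × ℕ)} (hT : ∀ r ∈ T, r.2.2 ≤ r.1)

include hT in
theorem State.meets_extend (G : State m n) (c : Fin m → Fin (n + 1)) :
    (G.extend c).Meets T ↔ G.Meets T ∧ ∀ j, ∀ s ∈ targets T n j, c j = s := by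
  constructor
  · intro h
    refine ⟨fun r hr i hi => ?_, fun j s hs => ?_⟩
    · rw [← h r hr i.castSucc hi, State.extend_castSucc]
    · have := h _ (mem_filter.1 hs).2 (Fin.last n) rfl
      rw [State.extend_last] at this
      exact Fin.ext this
  · rintro ⟨h₁, h₂⟩ r hr i hi
    induction i using Fin.lastCases with
    | last =>
      have h0 : r.1 = n := hi.symm
      have hle := hT r hr
      have := h₂ r.2.1 ⟨r.2.2, by omega⟩ (by simp [targets, ← h0, hr])
      rw [State.extend_last, this]
    | cast i =>
      rw [State.extend_castSucc]
      exact h₁ r hr i hi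

/-- The orders lost between steps `n` and `n + 1` are exactly those that prescribed draws restore in
`sum_draws_le`. -/
theorem pending_succ_add (n : ℕ) (a : Fin (n + 1)) :
    pending T (n + 1) a + ∑ j, (if a ∈ targets T n j then 1 else 0) = pending T n a := by
  have h : #{r ∈ T | n = r.1 ∧ r.2.2 = (a : ℕ)} = ∑ j, (if a ∈ targets T n j then 1 else 0) := by
    rw [Finset.sum_boole, Nat.cast_id]
    refine card_nbij' (fun r => r.2.1) (fun j => (n, j, a)) ?_ ?_ ?_ ?_
    · rintro ⟨i, j, b⟩ h
      simp only [coe_filter, Set.mem_ofPred_eq] at h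
      obtain ⟨h, rfl, rfl⟩ := h
      simpa [targets] using h
    · intro j h
      simpa [targets] using h
    · rintro ⟨i, j, b⟩ h
      simp only [coe_filter, Set.mem_ofPred_eq] at h
      obtain ⟨h, rfl, rfl⟩ := h
      rfl
    · intro j h
      rfl
  rw [← h, pending, pending, ← card_union_of_disjoint]
  · congr 1
    ext r
    simp only [mem_union, mem_filter, ← and_or_left, and_congr_right_iff]
    omega
  · refine disjoint_filter.2 fun r _ h => ?_
    omega

theorem sum_pending (n : ℕ) :
    ∑ a : Fin (n + 1), pending T n a = #{r ∈ T | n ≤ r.1 ∧ r.2.2 ≤ n} := by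
  rw [card_eq_sum_card_fiberwise (t := range (n + 1)) (f := fun r => r.2.2)
    (fun r hr => by simp at hr ⊢; omega), ← Fin.sum_univ_eq_sum_range
    (fun a => #{r ∈ {r ∈ T | n ≤ r.1 ∧ r.2.2 ≤ n} | r.2.2 = a})]
  refine sum_congr rfl fun a _ => ?_
  have := a.isLt
  rw [pending, filter_filter]
  congr 1
  ext r
  simp only [mem_filter, and_congr_right_iff]
  omega

include hT in
theorem sum_card_targets (n : ℕ) : ∑ j, #(targets T n j) = #{r ∈ T | r.1 = n} := by
  rw [← card_sigma]
  refine card_nbij (fun p => (n, p.1, (p.2 : ℕ))) ?_ ?_ ?_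
  · rintro ⟨j, a⟩ h
    simpa [targets] using h
  · rintro ⟨j, a⟩ _ ⟨j', a'⟩ _ h
    simp only [Prod.mk.injEq, true_and] at h
    obtain ⟨rfl, h⟩ := h
    rw [Fin.ext h]
  · rintro ⟨i, j, a⟩ h
    simp only [coe_filter, Set.mem_ofPred_eq] at h
    obtain ⟨h, rfl⟩ := h
    have := hT _ h
    exact ⟨⟨j, ⟨a, by simp at this; omega⟩⟩, by simpa [targets] using h, rfl⟩

open Classical in
/-- The indicator of `Meets`, weighted by the potential of the edges that are still pending. -/
noncomputable def potential (δ : ℝ) (T : Finset (ℕ × Fin m × ℕ)) (G : State m n) : ℝ :=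
  (if G.Meets T then 1 else 0) * ∏ v : Fin (n + 1), rise (G.degree v + δ) (pending T n v)

include hT in
-- The one-step near-supermartingale bound. The old vertices are handled by `sum_draws_le`; the new
-- vertex has degree `m`, whence the separate rising factorial.
theorem sum_potential_extend_le (hδ : 0 < δ) (G : State m n) :
    ∑ c : Fin m → Fin (n + 1), (∏ j, ((G.degree (c j) : ℝ) + δ) / totalWeight m δ n) *
        potential δ T (G.extend c)
      ≤ ((1 / totalWeight m δ n) ^ #{r ∈ T | r.1 = n} *
          (1 + #{r ∈ T | n ≤ r.1 ∧ r.2.2 ≤ n} / totalWeight m δ n) ^ m *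
          rise (m + δ) (pending T (n + 1) (n + 1))) * potential δ T G := by
  classical
  have hL := totalWeight_pos hδ m n
  have hx : ∀ v, 0 < (G.degree v : ℝ) + δ := fun v => by positivity
  have key := sum_draws_le hx G.sum_weight hL (fun v : Fin (n + 1) => pending T (n + 1) v) m
    (fun v => le_rfl) (targets T n) (D := #{r ∈ T | n ≤ r.1 ∧ r.2.2 ≤ n}) (by
      rw [← sum_pending, Nat.cast_sum]
      exact (sum_congr rfl fun a _ => by rw [pending_succ_add]).le)
  rw [prod_mul_distrib, prod_pow_eq_pow_sum, sum_card_targets hT, prod_const, card_univ,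
    Fintype.card_fin] at key
  simp only [pending_succ_add] at key
  have h : ∀ c : Fin m → Fin (n + 1), (∏ j, ((G.degree (c j) : ℝ) + δ) / totalWeight m δ n) *
        potential δ T (G.extend c)
      = ((if G.Meets T then 1 else 0) * rise (m + δ) (pending T (n + 1) (n + 1))) *
        ((∏ j, ((G.degree (c j) : ℝ) + δ) / totalWeight m δ n *
          (if ∀ s ∈ targets T n j, c j = s then 1 else 0)) *
        ∏ a, rise ((G.degree a : ℝ) + δ + ∑ j, if c j = a then 1 else 0)
          (pending T (n + 1) a)) := by
    intro c
    have hd : ∀ v : Fin (n + 1), ((G.extend c).degree v.castSucc : ℝ) + δ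
        = (G.degree v : ℝ) + δ + ∑ j, if c j = v then 1 else 0 := by
      intro v
      rw [State.degree_extend_castSucc]
      push_cast
      ring
    have hi : (if (G.extend c).Meets T then (1 : ℝ) else 0) = (if G.Meets T then 1 else 0) *
        ∏ j, (if ∀ s ∈ targets T n j, c j = s then 1 else 0) := by
      rw [prod_indicator]
      simp only [State.meets_extend hT, ite_and]
      split_ifs <;> simp
    rw [potential, Fin.prod_univ_castSucc, State.degree_extend_last, hi, prod_mul_distrib]
    simp only [hd, Fin.val_castSucc, Fin.val_last]
    ring
  rw [sum_congr rfl fun c _ => h c, ← mul_sum]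
  have h0 : 0 ≤ (if G.Meets T then (1 : ℝ) else 0) * rise (m + δ) (pending T (n + 1) (n + 1)) :=
    mul_nonneg (by positivity) (rise_nonneg (by positivity) _)
  refine (le_of_eq ?_).trans ((mul_le_mul_of_nonneg_left key h0).trans (le_of_eq ?_))
  · congr!
  · rw [potential]
    ring

/-- The contribution of the triple `r` to the bound for the step from `G_n` to `G_{n+1}`. -/
noncomputable def stepFactor (m : ℕ) (δ K : ℝ) (n : ℕ) (r : ℕ × Fin m × ℕ) : ℝ :=
  (if r.1 = n then 1 / totalWeight m δ n else 1) *
    (if n ≤ r.1 ∧ r.2.2 ≤ n then (1 + 1 / totalWeight m δ n) ^ m else 1) *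
    (if r.2.2 = n + 1 then K else 1)

include hT in
-- The one-step factor is split over the single requirements, so that the product over all steps can
-- be regrouped edge by edge.
theorem expect_potential_succ_le (hδ : 0 < δ) :
    expect m δ hδ (n + 1) (potential δ T) ≤
      (∏ r ∈ T, stepFactor m δ (m + δ + #T) n r) * expect m δ hδ n (potential δ T) := by
  classical
  have hL := totalWeight_pos hδ m n
  rw [expect_succ]
  refine (expect_mono hδ fun G => sum_potential_extend_le hT hδ G).trans ?_
  rw [expect_const_mul]
  refine mul_le_mul_of_nonneg_right ?_ ?_
  · simp only [stepFactor, prod_mul_distrib, prod_ite, prod_const, one_pow, mul_one]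
    -- Bernoulli's inequality turns the joint factor into one factor per pending requirement.
    have h1 : (1 + #{r ∈ T | n ≤ r.1 ∧ r.2.2 ≤ n} / totalWeight m δ n) ^ m
        ≤ ((1 + 1 / totalWeight m δ n) ^ m) ^ #{r ∈ T | n ≤ r.1 ∧ r.2.2 ≤ n} := by
      rw [pow_right_comm]
      refine pow_le_pow_left₀ (by positivity) ?_ m
      have h := one_add_mul_le_pow (a := 1 / totalWeight m δ n)
        (by have : 0 ≤ 1 / totalWeight m δ n := by positivity
            linarith) #{r ∈ T | n ≤ r.1 ∧ r.2.2 ≤ n}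
      rwa [mul_one_div] at h
    -- Edges to `n + 1` can only be attached from step `n + 1` on, so all requirements with this
    -- target are still pending.
    have h2 : rise (m + δ) (pending T (n + 1) (n + 1))
        ≤ (m + δ + #T : ℝ) ^ #{r ∈ T | r.2.2 = n + 1} := by
      have : pending T (n + 1) (n + 1) = #{r ∈ T | r.2.2 = n + 1} := by
        rw [pending]
        congr 1
        refine filter_congr fun r hr => ?_
        have := hT r hr
        omega
      rw [this]
      exact rise_le_pow (by positivity) (card_filter_le _ _)
    have h3 := rise_nonneg (x := m + δ) (by positivity) (pending T (n + 1) (n + 1))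
    gcongr
  · refine sum_nonneg fun G _ => mul_nonneg ENNReal.toReal_nonneg ?_
    exact mul_nonneg (by positivity) (prod_nonneg fun v _ => rise_nonneg (by positivity) _)

/-- The bound for the contribution of one edge from `i + 1` to `a` to the probability that
prescribed edges are present. -/
noncomputable def edgeBound (m : ℕ) (δ : ℝ) (i a : ℕ) : ℝ :=
  1 / totalWeight m δ i * ∏ t ∈ Icc a i, (1 + 1 / totalWeight m δ t) ^ m

open Classical in
include hT in
/-- An upper bound for the probability that all prescribed edges are present. -/
theorem expect_meets_le (hδ : 0 < δ) (N : ℕ) (hN : ∀ r ∈ T, r.1 < N) :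
    expect m δ hδ N (fun G => if G.Meets T then 1 else 0) ≤
      ∏ r ∈ T, ((m + δ + #T) * edgeBound m δ r.1 r.2.2) := by
  -- At time `N` nothing is pending, so the potential is the bare indicator.
  have h1 : expect m δ hδ N (fun G => if G.Meets T then 1 else 0)
      = expect m δ hδ N (potential δ T) := by
    congr 1
    ext G
    have : ∀ v, pending T N v = 0 := by
      intro v
      rw [pending, card_eq_zero, filter_eq_empty_iff]
      intro r hr
      have := hN r hr
      omega
    simp [potential, this, rise_zero]
  -- The last product is the initial value: vertex 0 is present from the start, with degree 0, and
  -- no step creates it.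
  have h2 : ∀ n, expect m δ hδ n (potential δ T) ≤
      (∏ r ∈ T, ∏ t ∈ range n, stepFactor m δ (m + δ + #T) t r) *
        ∏ r ∈ T, (if r.2.2 = 0 then (m + δ + #T : ℝ) else 1) := by
    intro n
    induction n with
    | zero =>
      have hM : State.Meets T (fun i => i.elim0 : State m 0) := fun r _ i => i.elim0
      rw [expect_zero, potential, if_pos hM]
      simp only [range_zero, prod_empty, prod_const_one, one_mul, prod_ite,
        prod_const, mul_one]
      have h0 : State.degree (fun i : Fin 0 => i.elim0 : State m 0) 0 = 0 := by
        simp [State.degree_eq]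
      have hp : pending T 0 0 = #{r ∈ T | r.2.2 = 0} := by simp [pending]
      refine (le_of_eq (Fin.prod_univ_one _)).trans ?_
      rw [h0]
      change rise ((0 : ℕ) + δ) (pending T 0 0) ≤ _
      rw [hp]
      have hr := rise_le_pow (x := (0 : ℕ) + δ) (by simpa using hδ.le)
        (card_filter_le T fun r => r.2.2 = 0)
      refine hr.trans (pow_le_pow_left₀ (by positivity) ?_ _)
      push_cast
      have := Nat.cast_nonneg (α := ℝ) m
      linarith
    | succ n ih =>
      refine (expect_potential_succ_le hT hδ).trans ?_
      have h0 : 0 ≤ ∏ r ∈ T, stepFactor m δ (m + δ + #T) n r := by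
        refine prod_nonneg fun r _ => ?_
        have := totalWeight_pos hδ m n
        unfold stepFactor
        positivity
      refine (mul_le_mul_of_nonneg_left ih h0).trans (le_of_eq ?_)
      simp only [prod_range_succ, prod_mul_distrib]
      ring
  rw [h1]
  refine (h2 N).trans (le_of_eq ?_)
  rw [← prod_mul_distrib]
  refine prod_congr rfl fun r hr => ?_
  have ha := hT r hr
  have hi := hN r hr
  simp only [stepFactor, prod_mul_distrib]
  rw [prod_ite_eq (range N) r.1, if_pos (mem_range.2 hi), edgeBound]
  have e1 : ∏ t ∈ range N, (if t ≤ r.1 ∧ r.2.2 ≤ t then (1 + 1 / totalWeight m δ t) ^ m else 1)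
      = ∏ t ∈ Icc r.2.2 r.1, (1 + 1 / totalWeight m δ t) ^ m := by
    rw [← prod_filter]
    congr 1
    ext t
    simp only [mem_filter, mem_range, mem_Icc]
    omega
  -- Each requirement pays the constant exactly once, when its target is born: step `t` creates
  -- vertex `t + 1`, and target 0 is paid for by the initial value.
  have e2 : (∏ t ∈ range N, (if r.2.2 = t + 1 then (m + δ + #T : ℝ) else 1)) *
      (if r.2.2 = 0 then (m + δ + #T : ℝ) else 1) = m + δ + #T := by
    rcases Nat.eq_zero_or_eq_succ_pred r.2.2 with h | h
    · rw [if_pos h, prod_eq_one fun t _ => if_neg (by omega), one_mul]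
    · have : ∀ t, (r.2.2 = t + 1) ↔ (r.2.2 - 1 = t) := fun t => by omega
      simp only [this]
      rw [prod_ite_eq, if_pos (mem_range.2 (by omega)), if_neg (by omega), mul_one]
  rw [e1, mul_assoc, e2]
  ring

open Classical in
include hT in
/-- A lower bound for the probability that all prescribed edges are present. -/
theorem le_expect_meets (hδ : 0 < δ) (hinj : ∀ n j, #(targets T n j) ≤ 1) (N : ℕ) :
    ∏ r ∈ T with r.1 < N, δ / totalWeight m δ r.1 ≤
      expect m δ hδ N (fun G => if G.Meets T then 1 else 0) := by
  induction N with
  | zero =>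
    have hM : State.Meets T (fun i => i.elim0 : State m 0) := fun r _ i => i.elim0
    rw [expect_zero, if_pos hM]
    simp
  | succ n ih =>
    have hL := totalWeight_pos hδ m n
    have hsplit : ∏ r ∈ T with r.1 < n + 1, δ / totalWeight m δ r.1
        = (δ / totalWeight m δ n) ^ #{r ∈ T | r.1 = n} *
          ∏ r ∈ T with r.1 < n, δ / totalWeight m δ r.1 := by
      have : ({r ∈ T | r.1 < n + 1} : Finset _) = {r ∈ T | r.1 = n} ∪ {r ∈ T | r.1 < n} := by
        ext r
        simp only [mem_union, mem_filter, ← and_or_left, and_congr_right_iff]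
        omega
      rw [this, prod_union (disjoint_filter.2 fun r _ h => by omega), ← prod_const]
      congr 1
      exact prod_congr rfl fun r hr => by rw [(mem_filter.1 hr).2]
    rw [hsplit, expect_succ]
    refine (mul_le_mul_of_nonneg_left ih (by positivity)).trans ?_
    rw [← expect_const_mul]
    refine expect_mono hδ fun G => ?_
    -- Degrees are nonnegative, so whatever `G` is, every vertex is drawn with probability at least
    -- `δ / totalWeight m δ n`.
    have key := le_sum_draws (p := fun v : Fin (n + 1) =>
        ((G.degree v : ℝ) + δ) / totalWeight m δ n) (q := δ / totalWeight m δ n)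
      (by rw [← sum_div, G.sum_weight, div_self hL.ne'])
      (fun v => by gcongr; simp) (by positivity) (targets T n) (hinj n)
    rw [prod_pow_eq_pow_sum, sum_card_targets hT] at key
    by_cases hG : G.Meets T
    · rw [if_pos hG, mul_one]
      refine key.trans (le_of_eq (sum_congr rfl fun c _ => ?_))
      rw [prod_mul_distrib]
      congr 1
      convert prod_indicator fun j => ∀ s ∈ targets T n j, c j = s
      simp only [State.meets_extend hT, hG, true_and]
    · rw [if_neg hG, mul_zero]
      refine sum_nonneg fun c _ => by positivity

end Requirements

end PrefAttach

namespace PrefAttach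

open Finset

/-! ### Analytic estimates -/

section Estimates

/-- The right side telescopes. The logarithm dominates 1/(t + 2), and the summable gap 1/(t + θ) −
1/(t + 2) is dominated by 2/θ times 1/(t + 1) − 1/(t + 2); the constant 2/θ is what small θ requires
at t = 0. -/
theorem one_div_add_le {θ : ℝ} (hθ : 0 < θ) (t : ℕ) :
    1 / (t + θ) ≤ (Real.log (t + 2) - 2 / θ / (t + 2)) - (Real.log (t + 1) - 2 / θ / (t + 1)) := by
  have h1 : 1 / ((t : ℝ) + 2) ≤ Real.log (t + 2) - Real.log (t + 1) := by
    have h := Real.one_sub_inv_le_log_of_pos (x := ((t : ℝ) + 2) / (t + 1)) (by positivity)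
    rw [Real.log_div (by positivity) (by positivity), inv_div] at h
    refine le_trans (le_of_eq ?_) h
    field_simp
    ring
  have h2 : 1 / ((t : ℝ) + θ) - 1 / (t + 2) ≤ 2 / θ / (t + 1) - 2 / θ / (t + 2) := by
    have hle : θ * (t + 1) * (2 - θ) ≤ 2 * (t + θ) := by
      have ht : (0 : ℝ) ≤ t := t.cast_nonneg
      nlinarith [mul_nonneg ht (sq_nonneg (θ - 1)), mul_nonneg ht hθ.le, sq_nonneg θ]
    have e1 : 1 / ((t : ℝ) + θ) - 1 / (t + 2) = (2 - θ) / ((t + θ) * (t + 2)) := by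
      field_simp
      ring
    have e2 : 2 / θ / ((t : ℝ) + 1) - 2 / θ / (t + 2) = 2 / (θ * (t + 1) * (t + 2)) := by
      field_simp
      ring
    rw [e1, e2, div_le_div_iff₀ (by positivity) (by positivity)]
    nlinarith [mul_le_mul_of_nonneg_right hle (by positivity : (0 : ℝ) ≤ t + 2)]
  linarith

theorem sum_one_div_add_le {θ : ℝ} (hθ : 0 < θ) {a i : ℕ} (h : a ≤ i) :
    ∑ t ∈ Icc a i, 1 / ((t : ℝ) + θ) ≤ Real.log (i + 2) - Real.log (a + 1) + 2 / θ := by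
  have key : ∑ t ∈ Icc a i, 1 / ((t : ℝ) + θ) ≤
      (Real.log (i + 2) - 2 / θ / (i + 2)) - (Real.log (a + 1) - 2 / θ / (a + 1)) := by
    induction i, h using Nat.le_induction with
    | base => simpa using one_div_add_le hθ a
    | succ i hi ih =>
      rw [← insert_Icc_right_eq_Icc_add_one (by omega), sum_insert (by simp)]
      have := one_div_add_le hθ (i + 1)
      push_cast at this ⊢
      have e1 : (i : ℝ) + 1 + 1 = i + 2 := by ring
      rw [e1] at this
      linarith
  have h1 : 0 ≤ 2 / θ / ((i : ℝ) + 2) := by positivity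
  have h2 : 2 / θ / ((a : ℝ) + 1) ≤ 2 / θ := div_le_self (by positivity) (by simp)
  linarith

theorem one_div_tau_sub_one {m : ℕ} (hm : 0 < m) (δ : ℝ) :
    1 / (tau m δ - 1) = m / (2 * m + δ) := by
  have : (0 : ℝ) < m := by exact_mod_cast hm
  have h : tau m δ - 1 = (2 * m + δ) / m := by
    rw [tau]
    field_simp
    ring
  rw [h, one_div_div]

/-- With θ = δ/(2m + δ), each factor is at most exp(m / totalWeight) = exp(χ/(t + θ)). The product
over a ≤ t ≤ i is then of order (i/a)^χ, and 1 / totalWeight supplies the remaining power −1 of `i`.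
-/
theorem exists_edgeBound_le {m : ℕ} (hm : 0 < m) {δ : ℝ} (hδ : 0 < δ) :
    ∃ C : ℝ, 0 < C ∧ ∀ a i : ℕ, a ≤ i → edgeBound m δ i a ≤
      C * (((a : ℝ) + 1) ^ (-(1 / (tau m δ - 1))) *
        ((i + 1 : ℕ) + 1 : ℝ) ^ (-(1 - 1 / (tau m δ - 1)))) := by
  rw [one_div_tau_sub_one hm δ]
  have hm' : (0 : ℝ) < m := by exact_mod_cast hm
  set χ : ℝ := m / (2 * m + δ) with hχ
  have hχ0 : 0 < χ := by positivity
  set θ : ℝ := δ / (2 * m + δ) with hθ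
  have hθ0 : 0 < θ := by positivity
  refine ⟨2 / δ * Real.exp (χ * (2 / θ)), by positivity, fun a i hai => ?_⟩
  have h1 : 1 / totalWeight m δ i ≤ 2 / δ * (1 / (i + 2)) := by
    rw [div_mul_div_comm, mul_one, div_le_div_iff₀ (totalWeight_pos hδ m i) (by positivity),
      totalWeight]
    have : (0 : ℝ) ≤ (4 * m + δ) * i := by positivity
    nlinarith
  have h2 : ∏ t ∈ Icc a i, (1 + 1 / totalWeight m δ t) ^ m ≤
      Real.exp (χ * (2 / θ)) * (((a : ℝ) + 1) ^ (-χ) * ((i : ℝ) + 2) ^ χ) := by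
    calc ∏ t ∈ Icc a i, (1 + 1 / totalWeight m δ t) ^ m
        ≤ ∏ t ∈ Icc a i, Real.exp (χ * (1 / (t + θ))) := by
          refine prod_le_prod (fun t _ => ?_) fun t _ => ?_
          · have := totalWeight_pos hδ m t
            positivity
          · have hL := totalWeight_pos hδ m t
            have h := pow_le_pow_left₀ (by positivity)
              (Real.add_one_le_exp (1 / totalWeight m δ t)) m
            rw [add_comm, ← Real.exp_nat_mul] at h
            refine h.trans (le_of_eq ?_)
            congr 1
            rw [hχ, hθ, totalWeight]
            field_simp
      _ = Real.exp (χ * ∑ t ∈ Icc a i, 1 / ((t : ℝ) + θ)) := by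
          rw [← Real.exp_sum, mul_sum]
      _ ≤ Real.exp (χ * (Real.log (i + 2) - Real.log (a + 1) + 2 / θ)) := by
          gcongr
          exact sum_one_div_add_le hθ0 hai
      _ = _ := by
          rw [Real.rpow_def_of_pos (by positivity), Real.rpow_def_of_pos (by positivity),
            ← Real.exp_add, ← Real.exp_add]
          congr 1
          ring
  rw [edgeBound]
  calc _ ≤ 2 / δ * (1 / (i + 2)) *
        (Real.exp (χ * (2 / θ)) * (((a : ℝ) + 1) ^ (-χ) * ((i : ℝ) + 2) ^ χ)) := by
        refine mul_le_mul h1 h2 (prod_nonneg fun t _ => ?_) (by positivity)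
        have := totalWeight_pos hδ m t
        positivity
    _ = _ := by
        have e : ((i + 1 : ℕ) + 1 : ℝ) = (i : ℝ) + 2 := by
          push_cast
          ring
        rw [e, neg_sub, Real.rpow_sub_one (by positivity)]
        ring

/-! ### Sums of powers over increasing maps -/

theorem mul_rpow_le_sub {y : ℝ} (hy : 0 < y) {v : ℕ} (hv : 0 < v) :
    y * ((v : ℝ) + 1) ^ (-1 - y) ≤ (v : ℝ) ^ (-y) - ((v : ℝ) + 1) ^ (-y) := by
  have hv' : (0 : ℝ) < v := by exact_mod_cast hv
  have h1 : (1 + y / (v + 1)) ≤ ((v : ℝ) / (v + 1)) ^ (-y) := by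
    have hl : Real.log ((v : ℝ) / (v + 1)) ≤ -(1 / (v + 1)) := by
      refine (Real.log_le_sub_one_of_pos (by positivity)).trans (le_of_eq ?_)
      field_simp
      ring
    rw [Real.rpow_def_of_pos (by positivity), add_comm]
    refine (Real.add_one_le_exp _).trans (Real.exp_le_exp.2 ?_)
    have := mul_le_mul_of_nonneg_left hl hy.le
    calc y / ((v : ℝ) + 1) = -(y * -(1 / (v + 1))) := by ring
      _ ≤ _ := by linarith
  have h2 : (v : ℝ) ^ (-y) = ((v : ℝ) / (v + 1)) ^ (-y) * ((v : ℝ) + 1) ^ (-y) := by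
    rw [← Real.mul_rpow (by positivity) (by positivity), div_mul_cancel₀ _ (by positivity)]
  have h3 : ((v : ℝ) + 1) ^ (-1 - y) = ((v : ℝ) + 1) ^ (-y) / (v + 1) := by
    rw [← Real.rpow_sub_one (by positivity)]
    congr 1
    ring
  rw [h2, h3]
  have := mul_le_mul_of_nonneg_right h1 (by positivity : 0 ≤ ((v : ℝ) + 1) ^ (-y))
  calc _ = (1 + y / (v + 1)) * ((v : ℝ) + 1) ^ (-y) - ((v : ℝ) + 1) ^ (-y) := by ring
    _ ≤ _ := by linarith

/-- The differences in `mul_rpow_le_sub` telescope. -/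
theorem sum_rpow_tail_le {y : ℝ} (hy : 0 < y) {a : ℕ} (ha : 0 < a) (N : ℕ) :
    ∑ v ∈ range N with a ≤ v, ((v : ℝ) + 1) ^ (-1 - y) ≤ 1 / y * (a : ℝ) ^ (-y) := by
  rcases le_or_gt N a with hN | hN
  · rw [filter_false_of_mem fun v hv => by simp at hv; omega, sum_empty]
    positivity
  have key : ∀ n, a ≤ n → y * ∑ v ∈ range n with a ≤ v, ((v : ℝ) + 1) ^ (-1 - y) ≤
      (a : ℝ) ^ (-y) - (n : ℝ) ^ (-y) := by
    intro n hn
    induction n, hn using Nat.le_induction with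
    | base =>
      rw [filter_false_of_mem fun v hv => by simp at hv; omega, sum_empty]
      simp
    | succ n hn ih =>
      have hv := mul_rpow_le_sub hy (v := n) (by omega)
      rw [sum_filter, sum_range_succ, if_pos (by omega), ← sum_filter, mul_add]
      push_cast
      linarith
  rw [one_div, inv_mul_eq_div, le_div_iff₀' hy]
  have : 0 ≤ (N : ℝ) ^ (-y) := by positivity
  linarith [key N hN.le]

open Classical in
/-- The strictly increasing maps with values at least `a`. -/
noncomputable def increasing (k a N : ℕ) : Finset (Fin k → Fin N) :=
  {f : Fin k → Fin N | StrictMono f ∧ ∀ s, a ≤ f s}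

theorem sum_increasing_succ {k : ℕ} (a N : ℕ) (x : Fin (k + 1) → ℝ) :
    ∑ f ∈ increasing (k + 1) a N, ∏ s, ((f s : ℝ) + 1) ^ (-x s) =
      ∑ v ∈ univ.filter fun v : Fin N => a ≤ (v : ℕ), ((v : ℝ) + 1) ^ (-x 0) *
        ∑ f ∈ increasing k (v + 1) N, ∏ s, ((f s : ℝ) + 1) ^ (-x s.succ) := by
  classical
  simp only [mul_sum]
  rw [sum_sigma']
  refine sum_bij (fun (f : Fin (k + 1) → Fin N) _ =>
    (⟨f 0, fun s => f s.succ⟩ : (_ : Fin N) × (Fin k → Fin N))) ?_ ?_ ?_ ?_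
  · intro f hf
    obtain ⟨hf, ha⟩ := (mem_filter.1 hf).2
    simp only [mem_sigma, mem_filter, mem_univ, true_and, increasing]
    exact ⟨ha 0, fun s t hst => hf (Fin.succ_lt_succ_iff.2 hst), fun s => hf (Fin.succ_pos s)⟩
  · intro f _ g _ h
    simp only [Sigma.mk.injEq, heq_eq_eq] at h
    funext s
    induction s using Fin.cases with
    | zero => exact h.1
    | succ s => exact congrFun h.2 s
  · rintro ⟨v, g⟩ h
    simp only [mem_sigma, mem_filter, mem_univ, true_and, increasing] at h
    obtain ⟨hv, hg, hvg⟩ := h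
    refine ⟨Fin.cons v g, ?_, by simp⟩
    simp only [mem_filter, mem_univ, true_and, increasing]
    refine ⟨?_, fun s => ?_⟩
    · intro s t hst
      induction t using Fin.cases with
      | zero => exact absurd hst (Fin.not_lt_zero s)
      | succ t =>
        induction s using Fin.cases with
        | zero => exact hvg t
        | succ s => exact hg (Fin.succ_lt_succ_iff.1 hst)
    · induction s using Fin.cases with
      | zero => exact hv
      | succ s =>
        have := hvg s
        simp only [Fin.cons_succ]
        omega
  · intro f _
    exact Fin.prod_univ_succ _

theorem sum_filter_succ_le {k : ℕ} (x : Fin (k + 1) → ℝ) (s : Fin k) :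
    ∑ i with s.succ ≤ i, x i = ∑ i with s ≤ i, x i.succ := by
  rw [sum_filter, Fin.sum_univ_succ, if_neg (by simp), zero_add, sum_filter]
  simp only [Fin.succ_le_succ_iff]

/-- Induction on `k`, with the younger vertices summed first. For smallest value `v`, the inner sum
is a power of `v + 1`, which leaves the exponent −1 − y at `v`. The hypothesis at position 0 says y
> 0, so the sum over v ≥ a converges, uniformly in `N`. -/
theorem exists_sum_increasing_le {k : ℕ} (x : Fin k → ℝ)
    (hx : ∀ s : Fin k, (k : ℝ) - s < ∑ i with s ≤ i, x i) :
    ∃ C : ℝ, 0 ≤ C ∧ ∀ a N : ℕ, 0 < a →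
      ∑ f ∈ increasing k a N, ∏ s, ((f s : ℝ) + 1) ^ (-x s) ≤
        C * (a : ℝ) ^ ((k : ℝ) - ∑ i, x i) := by
  induction k with
  | zero =>
    refine ⟨1, zero_le_one, fun a N _ => ?_⟩
    simp only [univ_eq_empty, prod_empty, sum_const, nsmul_eq_mul, mul_one, sum_empty,
      CharP.cast_eq_zero, sub_zero, Real.rpow_zero]
    exact_mod_cast (card_le_univ _).trans (by simp)
  | succ k ih =>
    obtain ⟨C, hC, h⟩ := ih (fun s => x s.succ) fun s => by
      have := hx s.succ
      rw [sum_filter_succ_le] at this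
      push_cast [Fin.val_succ] at this
      linarith
    have h0 := hx 0
    rw [filter_true_of_mem fun i _ => Fin.zero_le i, Fin.val_zero, Nat.cast_zero, sub_zero] at h0
    push_cast at h0
    set y : ℝ := ∑ i, x i - (k + 1) with hy
    have hy0 : 0 < y := by linarith
    refine ⟨C * (1 / y), by positivity, fun a N ha => (sum_increasing_succ a N x).trans_le ?_⟩
    calc _ ≤ ∑ v ∈ univ.filter fun v : Fin N => a ≤ (v : ℕ), C * ((v : ℝ) + 1) ^ (-1 - y) := by
          refine sum_le_sum fun v _ => ?_
          refine (mul_le_mul_of_nonneg_left (h (v + 1) N (by omega)) (by positivity)).trans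
            (le_of_eq ?_)
          push_cast
          rw [mul_left_comm, ← Real.rpow_add (by positivity), hy, Fin.sum_univ_succ]
          congr 2
          ring
      _ = C * ∑ v ∈ range N with a ≤ v, ((v : ℝ) + 1) ^ (-1 - y) := by
          rw [← mul_sum, sum_filter, sum_filter,
            ← Fin.sum_univ_eq_sum_range fun v => if a ≤ v then ((v : ℝ) + 1) ^ (-1 - y) else 0]
      _ ≤ C * (1 / y * (a : ℝ) ^ (-y)) := by
          gcongr
          exact sum_rpow_tail_le hy0 ha N
      _ = _ := by
          rw [hy, neg_sub, ← mul_assoc]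
          push_cast
          rfl

theorem sum_one_div_le_log (N : ℕ) : ∑ v : Fin N, 1 / ((v : ℝ) + 1) ≤ 1 + Real.log N := by
  rw [Fin.sum_univ_eq_sum_range fun v => 1 / ((v : ℝ) + 1)]
  refine le_trans (le_of_eq ?_) (harmonic_le_one_add_log N)
  simp [harmonic]

open Classical in
-- The strict tail conditions bound the sum over all vertices but the oldest. The total exponent is
-- exactly `k`, so the oldest vertex is left with exponent −1 and yields a harmonic sum.
theorem exists_sum_strictMono_le {k : ℕ} (hk : 0 < k) (x : Fin k → ℝ) (hx0 : ∑ i, x i = k)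
    (hx : ∀ s : Fin k, 0 < (s : ℕ) → (k : ℝ) - s < ∑ i with s ≤ i, x i) :
    ∃ C : ℝ, 0 ≤ C ∧ ∀ N : ℕ, ∑ f : Fin k → Fin N with StrictMono f,
      ∏ s, ((f s : ℝ) + 1) ^ (-x s) ≤ C * (1 + Real.log N) := by
  obtain ⟨k, rfl⟩ := Nat.exists_eq_succ_of_ne_zero hk.ne'
  obtain ⟨C, hC, h⟩ := exists_sum_increasing_le (fun s => x s.succ) fun s => by
    have := hx s.succ (by simp)
    rw [sum_filter_succ_le] at this
    push_cast [Fin.val_succ] at this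
    linarith
  refine ⟨C, hC, fun N => ?_⟩
  have h0 : ({f : Fin (k + 1) → Fin N | StrictMono f} : Finset _) = increasing (k + 1) 0 N := by
    simp [increasing]
  rw [h0, sum_increasing_succ, filter_true_of_mem fun (v : Fin N) _ => Nat.zero_le (v : ℕ)]
  refine le_trans ?_ (mul_le_mul_of_nonneg_left (sum_one_div_le_log N) hC)
  rw [mul_sum]
  refine sum_le_sum fun v _ => ?_
  refine (mul_le_mul_of_nonneg_left (h (v + 1) N (by omega)) (by positivity)).trans (le_of_eq ?_)
  push_cast
  rw [mul_left_comm, ← Real.rpow_add (by positivity), one_div, ← Real.rpow_neg_one]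
  rw [Fin.sum_univ_succ] at hx0
  push_cast at hx0
  congr 2
  linarith

open Classical in
-- With q = v / (k + 1), the value at each position `s` below the last can be chosen freely in the
-- block [sq, (s + 1)q); the blocks are disjoint, increasing and below `v`.
theorem pow_le_card_strictMono {k N : ℕ} (v : Fin N) :
    ((v : ℕ) / (k + 1)) ^ k ≤ #{f : Fin (k + 1) → Fin N | StrictMono f ∧ f (Fin.last k) = v} := by
  set q := (v : ℕ) / (k + 1) with hq
  have hqv : q * (k + 1) ≤ v := Nat.div_mul_le_self _ _
  have hlt : ∀ (s : Fin k) (g : Fin q), (s : ℕ) * q + g < v := by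
    intro s g
    have := Nat.mul_le_mul_right q (Nat.succ_le_of_lt s.isLt)
    have := g.isLt
    nlinarith
  let F : (Fin k → Fin q) → Fin (k + 1) → Fin N := fun g =>
    Fin.snoc (α := fun _ => Fin N) (fun s => ⟨s * q + g s, (hlt s (g s)).trans v.isLt⟩) v
  have hF : ∀ g s, (F g (Fin.castSucc s) : ℕ) = s * q + g s := by
    intro g s
    simp only [F, Fin.snoc_castSucc]
  calc q ^ k = #(univ : Finset (Fin k → Fin q)) := by simp
    _ ≤ _ := card_le_card_of_injOn F ?_ ?_
  · intro g _
    simp only [coe_filter, mem_univ, true_and, Set.mem_ofPred_eq]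
    refine ⟨fun s t hst => ?_, by simp [F]⟩
    induction t using Fin.lastCases with
    | last =>
      induction s using Fin.lastCases with
      | last => exact absurd hst (lt_irrefl _)
      | cast s =>
        rw [Fin.lt_def, hF]
        simpa [F] using hlt s (g s)
    | cast t =>
      induction s using Fin.lastCases with
      | last => exact absurd hst (not_lt_of_ge (Fin.le_last _))
      | cast s =>
        rw [Fin.lt_def, hF, hF]
        have := Nat.mul_le_mul_right q (Nat.succ_le_of_lt (Fin.castSucc_lt_castSucc_iff.1 hst))
        have := (g s).isLt
        simp only [Nat.succ_eq_add_one] at *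
        nlinarith
  · intro g _ g' _ h
    funext s
    have := hF g s
    rw [h, hF] at this
    exact Fin.ext (by omega)

open Classical in
-- Grouped by the largest value v, at least of order v^k maps contribute (v + 1)^(−(k+1)) each, so a
-- harmonic sum remains.
theorem exists_le_sum_strictMono (k : ℕ) :
    ∃ c : ℝ, 0 < c ∧ ∀ᶠ N : ℕ in Filter.atTop, c * Real.log N ≤
      ∑ f : Fin (k + 1) → Fin N with StrictMono f,
        (1 / ((f (Fin.last k) : ℝ) + 1)) ^ (k + 1) := by
  -- For v ≥ M the quotient v / (k + 1) is at least 1, so v + 1 is at most 2(k + 1) times it. The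
  -- smaller v cost only a constant.
  set M := 2 * k + 3 with hM
  have hbound : ∀ N : ℕ, (1 / (2 * (k + 1)) : ℝ) ^ k * (Real.log N - (1 + Real.log M)) ≤
      ∑ f : Fin (k + 1) → Fin N with StrictMono f,
        (1 / ((f (Fin.last k) : ℝ) + 1)) ^ (k + 1) := by
    intro N
    have h1 : ∑ v ∈ univ.filter fun v : Fin N => M ≤ (v : ℕ),
        (1 / (2 * (k + 1)) : ℝ) ^ k * (1 / ((v : ℝ) + 1)) ≤
        ∑ f : Fin (k + 1) → Fin N with StrictMono f,
          (1 / ((f (Fin.last k) : ℝ) + 1)) ^ (k + 1) := by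
      rw [← sum_fiberwise _ (fun f : Fin (k + 1) → Fin N => f (Fin.last k))]
      refine (sum_le_sum fun v hv => ?_).trans
        (sum_le_sum_of_subset_of_nonneg (filter_subset _ _) fun v _ _ =>
          sum_nonneg fun f _ => by positivity)
      have hv : M ≤ (v : ℕ) := (mem_filter.1 hv).2
      rw [filter_filter, sum_congr rfl fun f hf => by rw [(mem_filter.1 hf).2.2], sum_const,
        nsmul_eq_mul, pow_succ, ← mul_assoc]
      refine mul_le_mul_of_nonneg_right ?_ (by positivity)
      have hc := Nat.cast_le (α := ℝ).2 (pow_le_card_strictMono (k := k) v)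
      rw [Nat.cast_pow] at hc
      refine le_trans ?_ (mul_le_mul_of_nonneg_right hc (by positivity))
      rw [← mul_pow]
      refine pow_le_pow_left₀ (by positivity) ?_ k
      have hq : ((v : ℕ) + 1) ≤ ((v : ℕ) / (k + 1)) * (2 * (k + 1)) := by
        have := Nat.div_add_mod (v : ℕ) (k + 1)
        have := Nat.mod_lt (v : ℕ) (Nat.succ_pos k)
        simp only [Nat.succ_eq_add_one] at this
        nlinarith
      have hq' : ((v : ℝ) + 1) ≤ (((v : ℕ) / (k + 1) : ℕ) : ℝ) * (2 * (k + 1)) := by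
        exact_mod_cast hq
      rw [mul_one_div, div_le_div_iff₀ (by positivity) (by positivity)]
      linarith
    refine le_trans ?_ h1
    rw [← mul_sum]
    refine mul_le_mul_of_nonneg_left ?_ (by positivity)
    have h2 : Real.log N ≤ ∑ v ∈ range N, 1 / ((v : ℝ) + 1) := by
      rcases Nat.eq_zero_or_pos N with rfl | hN
      · simp
      refine (Real.log_le_log (by exact_mod_cast hN) (by exact_mod_cast N.le_succ)).trans
        ((log_add_one_le_harmonic N).trans (le_of_eq ?_))
      simp [harmonic]
    have h3 : ∑ v ∈ range N with ¬ M ≤ v, 1 / ((v : ℝ) + 1) ≤ 1 + Real.log M := by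
      refine le_trans ?_ (sum_one_div_le_log M)
      rw [Fin.sum_univ_eq_sum_range fun v => 1 / ((v : ℝ) + 1)]
      refine sum_le_sum_of_subset_of_nonneg (fun v hv => ?_) fun v _ _ => by positivity
      simpa using (mem_filter.1 hv).2
    rw [← sum_filter_add_sum_filter_not _ fun v => M ≤ v] at h2
    have h4 : ∑ v ∈ univ.filter fun v : Fin N => M ≤ (v : ℕ), 1 / ((v : ℝ) + 1) =
        ∑ v ∈ range N with M ≤ v, 1 / ((v : ℝ) + 1) := by
      rw [sum_filter, sum_filter,
        ← Fin.sum_univ_eq_sum_range fun v => if M ≤ v then 1 / ((v : ℝ) + 1) else 0]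
    rw [h4]
    linarith
  refine ⟨(1 / (2 * (k + 1)) : ℝ) ^ k / 2, by positivity, ?_⟩
  have hlog : Filter.Tendsto (fun N : ℕ => Real.log N) Filter.atTop Filter.atTop :=
    Real.tendsto_log_atTop.comp tendsto_natCast_atTop_atTop
  filter_upwards [hlog.eventually_ge_atTop (2 * (1 + Real.log M))] with N hN
  refine le_trans ?_ (hbound N)
  rw [div_mul_eq_mul_div, mul_div_assoc]
  refine mul_le_mul_of_nonneg_left ?_ (by positivity)
  linarith

end Estimates

end PrefAttach

namespace PrefAttach

open Finset

/-! ### Ordered edges and the exponent -/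

section OrderedEdges

variable {V : Type*} {k : ℕ}

open Classical in
/-- The edges of `H`, as pairs of positions; the first position is that of the older vertex. -/
noncomputable def orderedEdges (H : SimpleGraph V) (π : V ≃ Fin k) : Finset (Fin k × Fin k) :=
  {p | p.1 < p.2 ∧ H.Adj (π.symm p.1) (π.symm p.2)}

variable {H : SimpleGraph V} {π : V ≃ Fin k}

theorem mem_orderedEdges {p : Fin k × Fin k} :
    p ∈ orderedEdges H π ↔ p.1 < p.2 ∧ H.Adj (π.symm p.1) (π.symm p.2) := by
  simp [orderedEdges]

theorem inDeg_eq_card (i : Fin k) :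
    inDeg H π (π.symm i) = #{p ∈ orderedEdges H π | p.1 = i} := by
  rw [inDeg, ← Set.ncard_coe_finset]
  refine Set.ncard_congr (fun u _ => (i, π u)) ?_ ?_ ?_
  · rintro u ⟨h₁, h₂⟩
    simpa [mem_orderedEdges, h₁] using h₂
  · intro u v _ _ h
    simpa using h
  · rintro ⟨a, b⟩ h
    simp only [coe_filter, mem_orderedEdges, Set.mem_ofPred_eq] at h
    obtain ⟨⟨h₁, h₂⟩, rfl⟩ := h
    exact ⟨π.symm b, ⟨h₂, by simpa using h₁⟩, by simp⟩

theorem outDeg_eq_card (i : Fin k) :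
    outDeg H π (π.symm i) = #{p ∈ orderedEdges H π | p.2 = i} := by
  rw [outDeg, ← Set.ncard_coe_finset]
  refine Set.ncard_congr (fun u _ => (π u, i)) ?_ ?_ ?_
  · rintro u ⟨h₁, h₂⟩
    simpa [mem_orderedEdges, h₁.symm] using h₂
  · intro u v _ _ h
    simpa using h
  · rintro ⟨a, b⟩ h
    simp only [coe_filter, mem_orderedEdges, Set.mem_ofPred_eq] at h
    obtain ⟨⟨h₁, h₂⟩, rfl⟩ := h
    exact ⟨π.symm a, ⟨h₂.symm, by simpa using h₁⟩, by simp⟩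

theorem inDeg_add_outDeg (v : V) : inDeg H π v + outDeg H π v = (H.neighborSet v).ncard := by
  have : Finite V := Finite.of_equiv _ π.symm
  rw [inDeg, outDeg, ← Set.ncard_union_eq]
  · congr 1
    ext u
    simp only [Set.mem_union, Set.mem_ofPred_eq, SimpleGraph.mem_neighborSet, ← and_or_left,
      and_iff_left_iff_imp]
    intro h
    exact lt_or_gt_of_ne fun e => h.ne (π.injective e)
  · exact Set.disjoint_left.2 fun u h h' => lt_asymm h.2 h'.2

theorem sum_inDeg_tail (s : ℕ) :
    ∑ i ∈ univ.filter fun i : Fin k => s ≤ (i : ℕ), inDeg H π (π.symm i) =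
      #{p ∈ orderedEdges H π | s ≤ (p.1 : ℕ)} := by
  rw [card_eq_sum_card_fiberwise (f := Prod.fst) (t := univ.filter fun i : Fin k => s ≤ (i : ℕ))
    fun p hp => by simpa using (mem_filter.1 hp).2]
  refine sum_congr rfl fun i hi => ?_
  rw [inDeg_eq_card, filter_filter]
  congr 1
  refine filter_congr fun p _ => ⟨fun h => ⟨?_, h⟩, fun h => h.2⟩
  rw [h]
  exact (mem_filter.1 hi).2

theorem sum_outDeg_tail (s : ℕ) :
    ∑ i ∈ univ.filter fun i : Fin k => s ≤ (i : ℕ), outDeg H π (π.symm i) =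
      #{p ∈ orderedEdges H π | s ≤ (p.2 : ℕ)} := by
  rw [card_eq_sum_card_fiberwise (f := Prod.snd) (t := univ.filter fun i : Fin k => s ≤ (i : ℕ))
    fun p hp => by simpa using (mem_filter.1 hp).2]
  refine sum_congr rfl fun i hi => ?_
  rw [outDeg_eq_card, filter_filter]
  congr 1
  refine filter_congr fun p _ => ⟨fun h => ⟨?_, h⟩, fun h => h.2⟩
  rw [h]
  exact (mem_filter.1 hi).2

/-- A walk from position 0 to position `s` crosses the cut. The crossing edge has its older end
before the cut and its younger end after it, so only the right side counts it. -/
theorem card_filter_fst_lt_card_filter_snd (hH : H.Connected) {s : ℕ} (hs : 0 < s) (hsk : s < k) :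
    #{p ∈ orderedEdges H π | s ≤ (p.1 : ℕ)} < #{p ∈ orderedEdges H π | s ≤ (p.2 : ℕ)} := by
  obtain ⟨w⟩ := hH.preconnected (π.symm ⟨0, by omega⟩) (π.symm ⟨s, hsk⟩)
  obtain ⟨d, -, hd₁, hd₂⟩ := w.exists_boundary_dart {v | (π v : ℕ) < s} (by simpa) (by simp)
  simp only [Set.mem_ofPred_eq, not_lt] at hd₁ hd₂
  refine card_lt_card (ssubset_iff_of_subset (fun p hp => ?_) |>.2
    ⟨(π d.fst, π d.snd), ?_, fun h => ?_⟩)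
  · obtain ⟨h₁, h₂⟩ := mem_filter.1 hp
    have := (mem_orderedEdges.1 h₁).1
    exact mem_filter.2 ⟨h₁, h₂.trans this.le⟩
  · refine mem_filter.2 ⟨mem_orderedEdges.2 ⟨?_, by simp [d.adj]⟩, hd₂⟩
    exact Fin.lt_def.2 (hd₁.trans_le hd₂)
  · exact absurd (mem_filter.1 h).2 (not_le.2 hd₁)

/-- Each of the k − s vertices in the tail has degree two; its edges to younger vertices are counted
in the first set, those to older ones in the second. -/
theorem card_filter_add_card_filter (hH : ∀ v, (H.neighborSet v).ncard = 2) (s : ℕ) :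
    #{p ∈ orderedEdges H π | s ≤ (p.1 : ℕ)} + #{p ∈ orderedEdges H π | s ≤ (p.2 : ℕ)} =
      2 * (k - s) := by
  rw [← sum_inDeg_tail, ← sum_outDeg_tail, ← sum_add_distrib]
  simp only [inDeg_add_outDeg, hH, sum_const, smul_eq_mul]
  have : #(univ.filter fun i : Fin k => s ≤ (i : ℕ)) = k - s := by
    rw [← Nat.card_Ico s k]
    refine card_nbij (fun i => (i : ℕ)) (fun i hi => ?_) (fun i _ j _ h => Fin.ext h)
      fun i hi => ?_
    · simpa using hi
    · simp only [coe_Ico, Set.mem_Ico] at hi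
      exact ⟨⟨i, hi.2⟩, by simpa using hi.1, rfl⟩
  rw [this, mul_comm]

theorem card_orderedEdges (hH : ∀ v, (H.neighborSet v).ncard = 2) : #(orderedEdges H π) = k := by
  have := card_filter_add_card_filter (π := π) hH 0
  simp only [Nat.zero_le, filter_true] at this
  omega

/-- The exponent with which the vertex at position `i` contributes. -/
noncomputable def vertexExponent (m : ℕ) (δ : ℝ) (H : SimpleGraph V) (π : V ≃ Fin k) (i : Fin k) :
    ℝ :=
  1 / (tau m δ - 1) * inDeg H π (π.symm i) + (1 - 1 / (tau m δ - 1)) * outDeg H π (π.symm i)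

theorem sum_vertexExponent_tail (m : ℕ) (δ : ℝ) (s : ℕ) :
    ∑ i ∈ univ.filter fun i : Fin k => s ≤ (i : ℕ), vertexExponent m δ H π i =
      1 / (tau m δ - 1) * #{p ∈ orderedEdges H π | s ≤ (p.1 : ℕ)} +
        (1 - 1 / (tau m δ - 1)) * #{p ∈ orderedEdges H π | s ≤ (p.2 : ℕ)} := by
  simp only [vertexExponent, sum_add_distrib, ← mul_sum, ← Nat.cast_sum, sum_inDeg_tail,
    sum_outDeg_tail]

theorem sum_vertexExponent (m : ℕ) (δ : ℝ) (hH : ∀ v, (H.neighborSet v).ncard = 2) :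
    ∑ i, vertexExponent m δ H π i = k := by
  have h := sum_vertexExponent_tail (H := H) (π := π) m δ 0
  simp only [Nat.zero_le, filter_true, card_orderedEdges hH] at h
  rw [h]
  ring

/-- The tail sum is χI + (1 − χ)O with I + O = 2(k − s) and I < O; as χ < 1/2, the larger weight
falls on the larger count. -/
theorem lt_sum_vertexExponent_tail {m : ℕ} (hm : 0 < m) {δ : ℝ} (hδ : 0 < δ)
    (hH : ∀ v, (H.neighborSet v).ncard = 2) (hc : H.Connected) {s : ℕ} (hs : 0 < s) (hsk : s < k) :
    (k : ℝ) - s < ∑ i ∈ univ.filter fun i : Fin k => s ≤ (i : ℕ), vertexExponent m δ H π i := by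
  have h₁ := card_filter_add_card_filter (π := π) hH s
  have h₂ := card_filter_fst_lt_card_filter_snd (π := π) hc hs hsk
  rw [sum_vertexExponent_tail, one_div_tau_sub_one hm]
  set I := #{p ∈ orderedEdges H π | s ≤ (p.1 : ℕ)}
  set O := #{p ∈ orderedEdges H π | s ≤ (p.2 : ℕ)}
  have h₁' : (I : ℝ) + O = 2 * (k - s) := by
    rw [← Nat.cast_sub hsk.le]
    exact_mod_cast h₁
  have h₂' : (I : ℝ) < O := by exact_mod_cast h₂
  have hχ : (m : ℝ) / (2 * m + δ) < 1 / 2 := by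
    have : (0 : ℝ) < m := by exact_mod_cast hm
    rw [div_lt_div_iff₀ (by positivity) (by positivity)]
    linarith
  nlinarith [mul_pos (sub_pos.2 hχ) (sub_pos.2 h₂')]

/-! ### Maximum of the exponent for a connected 2-regular graph -/

theorem exponent_eq (m : ℕ) (δ : ℝ) (s : ℕ) : exponent m δ H π s =
    -(s : ℝ) - ∑ i ∈ univ.filter fun i : Fin k => s ≤ (i : ℕ), vertexExponent m δ H π i := rfl

theorem exponent_zero (m : ℕ) (δ : ℝ) (hH : ∀ v, (H.neighborSet v).ncard = 2) :
    exponent m δ H π 0 = -(k : ℝ) := by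
  rw [exponent_eq]
  simp [sum_vertexExponent m δ hH]

theorem exponent_self (m : ℕ) (δ : ℝ) : exponent m δ H π k = -(k : ℝ) := by
  rw [exponent_eq, filter_false_of_mem fun i _ => not_le.2 i.isLt]
  simp

theorem exponent_lt {m : ℕ} (hm : 0 < m) {δ : ℝ} (hδ : 0 < δ)
    (hH : ∀ v, (H.neighborSet v).ncard = 2) (hc : H.Connected) {s : ℕ} (hs : 0 < s) (hsk : s < k) :
    exponent m δ H π s < -(k : ℝ) := by
  have := lt_sum_vertexExponent_tail (π := π) hm hδ hH hc hs hsk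
  rw [exponent_eq]
  linarith

theorem exponent_le {m : ℕ} (hm : 0 < m) {δ : ℝ} (hδ : 0 < δ)
    (hH : ∀ v, (H.neighborSet v).ncard = 2) (hc : H.Connected) {s : ℕ} (hsk : s ≤ k) :
    exponent m δ H π s ≤ -(k : ℝ) := by
  rcases Nat.eq_zero_or_pos s with rfl | hs
  · exact (exponent_zero m δ hH).le
  rcases hsk.eq_or_lt with rfl | hsk
  · exact (exponent_self m δ).le
  · exact (exponent_lt hm hδ hH hc hs hsk).le

theorem B_eq {m : ℕ} (hm : 0 < m) {δ : ℝ} (hδ : 0 < δ)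
    (hH : ∀ v, (H.neighborSet v).ncard = 2) (hc : H.Connected) : B m δ H π = -(k : ℝ) := by
  refine le_antisymm (sup'_le _ _ fun s hs => ?_) ?_
  · exact exponent_le hm hδ hH hc (Nat.lt_succ_iff.1 (mem_range.1 hs))
  · rw [← exponent_self (H := H) (π := π) m δ]
    exact le_sup' (exponent m δ H π) (mem_range.2 k.lt_succ_self)

theorem optimizers_eq {m : ℕ} (hm : 0 < m) {δ : ℝ} (hδ : 0 < δ)
    (hH : ∀ v, (H.neighborSet v).ncard = 2) (hc : H.Connected) :
    optimizers m δ H π = {0, k} := by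
  ext s
  rw [optimizers, mem_filter, B_eq hm hδ hH hc, mem_range, mem_insert, mem_singleton]
  constructor
  · rintro ⟨h₁, h₂⟩
    by_contra! h
    exact (exponent_lt hm hδ hH hc (by omega) (by omega)).ne h₂
  · rintro (rfl | rfl)
    · exact ⟨by omega, exponent_zero m δ hH⟩
    · exact ⟨by omega, exponent_self m δ⟩

theorem ncard_neighborSet_of_iso_cycleGraph (hk : 3 ≤ k) (e : H ≃g SimpleGraph.cycleGraph k)
    (v : V) : (H.neighborSet v).ncard = 2 := by
  classical
  obtain ⟨k, rfl⟩ := Nat.exists_eq_add_of_le' hk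
  rw [← Nat.card_coe_set_eq, Nat.card_congr (e.mapNeighborSet v), Nat.card_eq_fintype_card,
    SimpleGraph.card_neighborSet_eq_degree, SimpleGraph.cycleGraph_degree_three_le]

theorem connected_of_iso_cycleGraph (hk : 3 ≤ k) (e : H ≃g SimpleGraph.cycleGraph k) :
    H.Connected := by
  obtain ⟨k, rfl⟩ := Nat.exists_eq_add_of_le' hk
  exact e.connected_iff.2 SimpleGraph.cycleGraph_connected

end OrderedEdges

end PrefAttach

namespace PrefAttach

open Finset

/-- Any choice of a related `b` is injective by `hR`. This suits copies that are described by a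
labelled map without a canonical choice of one. -/
theorem ncard_le_card_of_rel {α β : Type*} {s : Set α} {t : Finset β} (R : α → β → Prop)
    (h : ∀ a ∈ s, ∃ b ∈ t, R a b) (hR : ∀ a a' b, R a b → R a' b → a = a') : s.ncard ≤ #t := by
  choose F hF hFR using fun a : s => h a.1 a.2
  rw [← Nat.card_coe_set_eq, ← Fintype.card_coe, ← Nat.card_eq_fintype_card]
  refine Nat.card_le_card_of_injective (fun a => (⟨F a, hF a⟩ : t)) fun a a' haa => ?_
  have e : F a = F a' := congrArg Subtype.val haa
  exact Subtype.ext (hR _ _ _ (hFR a) (e ▸ hFR a'))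

/-! ### Counting copies through increasing maps -/

section CountingMaps

variable {V : Type*} {k m n : ℕ} {H : SimpleGraph V} {π : V ≃ Fin k}

theorem State.isLink_iff {G : State m n} {x : Fin n × Fin m} {a b : Fin (n + 1)} :
    G.toGraph.IsLink x a b ↔ ((a : ℕ) = x.1 + 1 ∧ (b : ℕ) = G x.1 x.2) ∨
      ((b : ℕ) = x.1 + 1 ∧ (a : ℕ) = G x.1 x.2) := by
  simp [State.toGraph, Fin.ext_iff]

theorem State.isLink_iff_of_lt {G : State m n} {x : Fin n × Fin m} {a b : Fin (n + 1)}
    (h : a < b) : G.toGraph.IsLink x a b ↔ (b : ℕ) = x.1 + 1 ∧ (a : ℕ) = G x.1 x.2 := by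
  rw [State.isLink_iff, or_iff_right]
  rintro ⟨h₁, h₂⟩
  have := (G x.1 x.2).isLt
  rw [Fin.lt_def] at h
  omega

/-- The triples prescribing that the edges of `H`, embedded by `f`, are present with the
labels `ℓ`. -/
noncomputable def required (m : ℕ) (H : SimpleGraph V) (π : V ≃ Fin k) (f : Fin k → Fin (n + 1))
    (ℓ : Fin k × Fin k → Fin m) : Finset (ℕ × Fin m × ℕ) :=
  (orderedEdges H π).image fun p => ((f p.2 : ℕ) - 1, ℓ p, (f p.1 : ℕ))

variable {f : Fin k → Fin (n + 1)} {ℓ : Fin k × Fin k → Fin m}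

theorem required_injOn (hf : StrictMono f) :
    Set.InjOn (fun p : Fin k × Fin k => ((f p.2 : ℕ) - 1, ℓ p, (f p.1 : ℕ)))
      (orderedEdges H π : Set (Fin k × Fin k)) := by
  intro p hp q hq h
  simp only [Prod.mk.injEq] at h
  obtain ⟨h₁, -, h₂⟩ := h
  have hp' := Fin.lt_def.1 (hf (mem_orderedEdges.1 hp).1)
  have hq' := Fin.lt_def.1 (hf (mem_orderedEdges.1 hq).1)
  exact Prod.ext (hf.injective (Fin.ext h₂)) (hf.injective (Fin.ext (by omega)))

theorem State.meets_required_iff (hf : StrictMono f) {G : State m n} :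
    G.Meets (required m H π f ℓ) ↔
      ∀ p ∈ orderedEdges H π, ∃ i, G.toGraph.IsLink (i, ℓ p) (f p.1) (f p.2) := by
  simp only [State.Meets, required, forall_mem_image]
  refine forall₂_congr fun p hp => ?_
  have hlt := hf (mem_orderedEdges.1 hp).1
  have hlt' := Fin.lt_def.1 hlt
  simp only [State.isLink_iff_of_lt hlt]
  constructor
  · intro h
    have h' := h ⟨f p.2 - 1, by omega⟩ rfl
    refine ⟨⟨f p.2 - 1, by omega⟩, ?_, h'.symm⟩
    simp only
    omega
  · rintro ⟨i, h₁, h₂⟩ j hj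
    have : i = j := Fin.ext (by omega)
    rw [← this, h₂]

open Classical in
/-- The pairs of an increasing map and a labelling of the edges that yield a copy of `H`. -/
noncomputable def labelledMaps (H : SimpleGraph V) (π : V ≃ Fin k) (G : State m n) :
    Finset ((Fin k → Fin (n + 1)) × (Fin k × Fin k → Fin m)) :=
  {q | StrictMono q.1 ∧ G.Meets (required m H π q.1 q.2)}

open Classical in
theorem card_labelledMaps (G : State m n) : (#(labelledMaps H π G) : ℝ) =
    ∑ f : Fin k → Fin (n + 1) with StrictMono f, ∑ ℓ : Fin k × Fin k → Fin m,
      if G.Meets (required m H π f ℓ) then 1 else 0 := by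
  rw [labelledMaps, card_filter, Nat.cast_sum, Fintype.sum_prod_type, sum_filter]
  refine sum_congr rfl fun f _ => ?_
  by_cases hf : StrictMono f <;> simp [hf]

theorem strictMono_of_forall_lt {e : V → Fin (n + 1)} (he : ∀ u v, π u < π v → e u < e v) :
    StrictMono fun i => e (π.symm i) :=
  fun i j hij => he _ _ (by simpa using hij)

/-- Listing the vertices of a copy by age gives the map, and since a copy has one edge per adjacent
pair, the labels of its edges then determine it. -/
theorem copies_le_card_labelledMaps (hm : 0 < m) (G : State m n) :
    copies H π G ≤ #(labelledMaps H π G) := by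
  classical
  let Describes (S : Graph (Fin (n + 1)) (Fin n × Fin m))
      (q : (Fin k → Fin (n + 1)) × (Fin k × Fin k → Fin m)) : Prop :=
    S.vertexSet = Set.range q.1 ∧ ∀ x a b, S.IsLink x a b ↔ ∃ p ∈ orderedEdges H π,
      (q.1 p.2 : ℕ) = x.1 + 1 ∧ x.2 = q.2 p ∧
        ((a = q.1 p.1 ∧ b = q.1 p.2) ∨ (b = q.1 p.1 ∧ a = q.1 p.2))
  have key : ∀ S ∈ {S : Graph (Fin (n + 1)) (Fin n × Fin m) | S ≤ G.toGraph ∧ S.Simple ∧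
      ∃ e : H ≃g S.toSimpleGraph,
        ∀ u v, π u < π v → (e u : Fin (n + 1)) < (e v : Fin (n + 1))},
      ∃ q ∈ labelledMaps H π G, Describes S q := by
    rintro S ⟨hS, hsimple, e, he⟩
    have hf := strictMono_of_forall_lt (e := fun v => (e v : Fin (n + 1))) he
    set f : Fin k → Fin (n + 1) := fun i => (e (π.symm i) : Fin (n + 1)) with hfdef
    have hadj : ∀ p, ∃ l : Fin m, p ∈ orderedEdges H π →
        ∃ i, S.IsLink (i, l) (f p.1) (f p.2) := by
      intro p
      by_cases hp : p ∈ orderedEdges H π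
      · have := (e.map_adj_iff.2 (mem_orderedEdges.1 hp).2).2
        obtain ⟨⟨i, l⟩, h⟩ := this
        exact ⟨l, fun _ => ⟨i, h⟩⟩
      -- Labels off the edges of `H` are arbitrary; the resulting overcount does no harm in an upper
      -- bound.
      · exact ⟨⟨0, hm⟩, fun h => absurd h hp⟩
    choose l hl using hadj
    refine ⟨(f, l), mem_filter.2 ⟨mem_univ _, hf, ?_⟩, ?_, ?_⟩
    · rw [State.meets_required_iff hf]
      exact fun p hp => (hl p hp).imp fun i hi => hi.mono hS
    · ext a
      constructor
      · intro ha
        refine ⟨π (e.symm ⟨a, ha⟩), ?_⟩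
        simp [hfdef]
      · rintro ⟨i, rfl⟩
        exact (e (π.symm i)).2
    · have hlt : ∀ x a b, a < b → S.IsLink x a b → ∃ p ∈ orderedEdges H π,
          (f p.2 : ℕ) = x.1 + 1 ∧ x.2 = l p ∧ a = f p.1 ∧ b = f p.2 := by
        intro x a b hab h
        set u := e.symm ⟨a, h.left_mem⟩ with hu
        set v := e.symm ⟨b, h.right_mem⟩ with hv
        have ha : f (π u) = a := by simp [hfdef, hu]
        have hb : f (π v) = b := by simp [hfdef, hv]
        have hp : (π u, π v) ∈ orderedEdges H π := by
          refine mem_orderedEdges.2 ⟨hf.lt_iff_lt.1 (by rwa [ha, hb]), ?_⟩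
          simp only [Equiv.symm_apply_apply]
          rw [← e.map_adj_iff]
          simp only [hu, hv, RelIso.apply_symm_apply]
          exact ⟨fun h' => hab.ne (congrArg Subtype.val h'), x, h⟩
        obtain ⟨i, hi⟩ := hl _ hp
        simp only [ha, hb] at hi
        -- Simplicity identifies the given edge with the one whose label was chosen.
        have hx := hsimple.eq_of_isLink h hi
        refine ⟨_, hp, ?_, by rw [hx], ha.symm, hb.symm⟩
        simp only [hb]
        exact ((State.isLink_iff_of_lt hab).1 (h.mono hS)).1
      intro x a b
      constructor
      · intro h
        rcases lt_trichotomy a b with hab | hab | hab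
        · obtain ⟨p, hp, h₁, h₂, h₃⟩ := hlt x a b hab h
          exact ⟨p, hp, h₁, h₂, .inl h₃⟩
        · exact absurd hab h.ne
        · obtain ⟨p, hp, h₁, h₂, h₃⟩ := hlt x b a hab h.symm
          exact ⟨p, hp, h₁, h₂, .inr h₃⟩
      · rintro ⟨p, hp, h₁, h₂, h₃⟩
        obtain ⟨i, hi⟩ := hl p hp
        have hx : x = (i, l p) := by
          have := ((State.isLink_iff_of_lt (hf (mem_orderedEdges.1 hp).1)).1 (hi.mono hS)).1
          exact Prod.ext (Fin.ext (by simp only at this h₁ ⊢; omega)) h₂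
        rw [hx]
        rcases h₃ with ⟨rfl, rfl⟩ | ⟨rfl, rfl⟩
        · exact hi
        · exact hi.symm
  refine ncard_le_card_of_rel Describes key fun S S' q d d' => ?_
  exact Graph.ext (d.1.trans d'.1.symm) fun x a b => (d.2 x a b).trans (d'.2 x a b).symm

/-- Here the map alone determines the copy; the labels only record some choice among parallel edges.
-/
theorem simpleCopies_le_card_labelledMaps (hm : 0 < m) (G : State m n) :
    simpleCopies H π G ≤ #(labelledMaps H π G) := by
  classical
  let Describes (S : G.toGraph.toSimpleGraph.Subgraph)
      (q : (Fin k → Fin (n + 1)) × (Fin k × Fin k → Fin m)) : Prop :=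
    (∀ a, a ∈ S.verts ↔ a.1 ∈ Set.range q.1) ∧ ∀ a b, S.Adj a b ↔
      ∃ i j, H.Adj (π.symm i) (π.symm j) ∧ a.1 = q.1 i ∧ b.1 = q.1 j
  have key : ∀ S ∈ {S : G.toGraph.toSimpleGraph.Subgraph | ∃ e : H ≃g S.coe,
      ∀ u v, π u < π v → ((e u).1 : Fin (n + 1)) < ((e v).1 : Fin (n + 1))},
      ∃ q ∈ labelledMaps H π G, Describes S q := by
    rintro S ⟨e, he⟩
    have hf := strictMono_of_forall_lt (e := fun v => ((e v).1 : Fin (n + 1))) he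
    set f : Fin k → Fin (n + 1) := fun i => ((e (π.symm i)).1 : Fin (n + 1)) with hfdef
    have hadj : ∀ p, ∃ l : Fin m, p ∈ orderedEdges H π →
        ∃ i, G.toGraph.IsLink (i, l) (f p.1) (f p.2) := by
      intro p
      by_cases hp : p ∈ orderedEdges H π
      · have := (S.adj_sub (e.map_adj_iff.2 (mem_orderedEdges.1 hp).2)).2
        obtain ⟨⟨i, l⟩, h⟩ := this
        exact ⟨l, fun _ => ⟨i, h⟩⟩
      · exact ⟨⟨0, hm⟩, fun h => absurd h hp⟩
    choose l hl using hadj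
    refine ⟨(f, l), mem_filter.2 ⟨mem_univ _, hf, ?_⟩, fun a => ?_, fun a b => ?_⟩
    · rw [State.meets_required_iff hf]
      exact hl
    · constructor
      · intro ha
        refine ⟨π (e.symm ⟨a, ha⟩), ?_⟩
        simp [hfdef]
      · rintro ⟨i, hi⟩
        rw [← Subtype.ext hi]
        exact (e (π.symm i)).2
    · constructor
      · intro h
        refine ⟨π (e.symm ⟨a, h.fst_mem⟩), π (e.symm ⟨b, h.snd_mem⟩), ?_, by simp [hfdef],
          by simp [hfdef]⟩
        rw [← e.map_adj_iff]
        simpa using h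
      · rintro ⟨i, j, hij, ha, hb⟩
        rw [Subtype.ext ha, Subtype.ext hb]
        exact e.map_adj_iff.2 hij
  refine ncard_le_card_of_rel Describes key fun S S' q d d' => ?_
  refine SimpleGraph.Subgraph.ext (Set.ext fun a => (d.1 a).trans (d'.1 a).symm) ?_
  ext a b
  exact (d.2 a b).trans (d'.2 a b).symm

/-! ### Copies built from increasing maps -/

theorem mem_orderedEdges_or_swap (i j : Fin k) :
    H.Adj (π.symm i) (π.symm j) ↔ (i, j) ∈ orderedEdges H π ∨ (j, i) ∈ orderedEdges H π := by
  simp only [mem_orderedEdges]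
  constructor
  · intro h
    rcases lt_trichotomy i j with hij | rfl | hij
    · exact .inl ⟨hij, h⟩
    · exact absurd h (H.irrefl)
    · exact .inr ⟨hij, h.symm⟩
  · rintro (⟨-, h⟩ | ⟨-, h⟩)
    · exact h
    · exact h.symm

open Classical in
/-- The increasing maps that yield a copy of `H` with the edge labels `ℓ`. -/
noncomputable def embeddings (H : SimpleGraph V) (π : V ≃ Fin k) (ℓ : Fin k × Fin k → Fin m)
    (G : State m n) : Finset (Fin k → Fin (n + 1)) :=
  {f | StrictMono f ∧ G.Meets (required m H π f ℓ)}

open Classical in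
theorem card_embeddings (G : State m n) : (#(embeddings H π ℓ G) : ℝ) =
    ∑ f : Fin k → Fin (n + 1) with StrictMono f,
      if G.Meets (required m H π f ℓ) then 1 else 0 := by
  rw [embeddings, ← filter_filter, card_filter, Nat.cast_sum]
  exact sum_congr rfl fun f _ => by simp

/-- An increasing map is recovered from its range, the vertex set of the copy it yields, so for
fixed labels different maps give different copies. -/
theorem card_embeddings_le_simpleCopies (G : State m n) :
    #(embeddings H π ℓ G) ≤ simpleCopies H π G := by
  classical
  have key : ∀ f ∈ embeddings H π ℓ G, ∃ S : G.toGraph.toSimpleGraph.Subgraph,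
      (∃ e : H ≃g S.coe, ∀ u v, π u < π v → ((e u).1 : Fin (n + 1)) < ((e v).1 : Fin (n + 1))) ∧
      ∀ a, a ∈ S.verts ↔ a.1 ∈ Set.range f := by
    intro f hf
    obtain ⟨hf, hG⟩ := (mem_filter.1 hf).2
    rw [State.meets_required_iff hf] at hG
    have hlink : ∀ i j, H.Adj (π.symm i) (π.symm j) → G.toGraph.Adj (f i) (f j) := by
      intro i j h
      rcases (mem_orderedEdges_or_swap i j).1 h with h | h
      · obtain ⟨t, ht⟩ := hG _ h
        exact ⟨_, ht⟩
      · obtain ⟨t, ht⟩ := hG _ h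
        exact ⟨_, ht.symm⟩
    let S : G.toGraph.toSimpleGraph.Subgraph :=
      { verts := {a | a.1 ∈ Set.range f}
        Adj := fun a b => ∃ i j, H.Adj (π.symm i) (π.symm j) ∧ a.1 = f i ∧ b.1 = f j
        adj_sub := by
          rintro a b ⟨i, j, h, ha, hb⟩
          refine ⟨fun hab => ?_, ?_⟩
          · have : f i = f j := by rw [← ha, ← hb, hab]
            rw [hf.injective this] at h
            exact H.irrefl h
          · rw [ha, hb]
            exact hlink i j h
        edge_vert := by
          rintro a b ⟨i, j, h, ha, hb⟩
          exact ⟨i, ha.symm⟩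
        symm := ⟨by
          rintro a b ⟨i, j, h, ha, hb⟩
          exact ⟨j, i, h.symm, hb, ha⟩⟩ }
    let F : V → S.verts := fun v => ⟨⟨f (π v), trivial⟩, π v, rfl⟩
    have hF : Function.Bijective F := by
      constructor
      · intro u v h
        have h' : f (π u) = f (π v) := congrArg (fun x : S.verts => x.1.1) h
        exact π.injective (hf.injective h')
      · rintro ⟨⟨a, ha⟩, i, hi⟩
        exact ⟨π.symm i, Subtype.ext (Subtype.ext (by simpa [F] using hi))⟩
    refine ⟨S, ⟨⟨Equiv.ofBijective F hF, ?_⟩, fun u v h => hf h⟩, fun a => Iff.rfl⟩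
    intro u v
    constructor
    · rintro ⟨i, j, h, hi, hj⟩
      have hi : π u = i := hf.injective hi
      have hj : π v = j := hf.injective hj
      simpa [← hi, ← hj] using h
    · intro h
      exact ⟨π u, π v, by simpa using h, rfl, rfl⟩
  rw [simpleCopies, ← Set.ncard_coe_finset]
  choose! F hF hFv using key
  refine Set.ncard_le_ncard_of_injOn F hF (fun f hf g hg h => ?_) (Set.toFinite _)
  have hf' := (mem_filter.1 hf).2.1
  have hg' := (mem_filter.1 hg).2.1
  refine (hf'.range_inj hg').1 (Set.ext fun a => ?_)
  rw [← hFv f hf ⟨a, trivial⟩, ← hFv g hg ⟨a, trivial⟩, h]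

theorem finite_graph (α β : Type*) [Finite α] [Finite β] : Finite (Graph α β) :=
  Finite.of_injective (fun S : Graph α β => (S.vertexSet, S.IsLink)) fun S S' h => by
    simp only [Prod.mk.injEq] at h
    exact Graph.ext h.1 fun x a b => by rw [h.2]

theorem card_embeddings_le_copies (G : State m n) : #(embeddings H π ℓ G) ≤ copies H π G := by
  classical
  have key : ∀ f ∈ embeddings H π ℓ G, ∃ S : Graph (Fin (n + 1)) (Fin n × Fin m),
      (S ≤ G.toGraph ∧ S.Simple ∧ ∃ e : H ≃g S.toSimpleGraph,
        ∀ u v, π u < π v → (e u : Fin (n + 1)) < (e v : Fin (n + 1))) ∧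
      S.vertexSet = Set.range f := by
    intro f hf
    obtain ⟨hf, hG⟩ := (mem_filter.1 hf).2
    rw [State.meets_required_iff hf] at hG
    -- Among parallel edges only the one with the label prescribed by `ℓ` is kept, which makes the
    -- copy simple.
    let R : Fin n × Fin m → Fin (n + 1) → Fin (n + 1) → Prop := fun x a b =>
      G.toGraph.IsLink x a b ∧ ∃ p ∈ orderedEdges H π, x.2 = ℓ p ∧
        ((a = f p.1 ∧ b = f p.2) ∨ (b = f p.1 ∧ a = f p.2))
    let S : Graph (Fin (n + 1)) (Fin n × Fin m) :=
      { vertexSet := Set.range f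
        IsLink := R
        isLink_symm := fun x _ => ⟨fun a b ⟨h, p, hp, hx, hab⟩ => ⟨h.symm, p, hp, hx, hab.symm⟩⟩
        eq_or_eq_of_isLink_of_isLink := fun x a b c d h h' =>
          G.toGraph.eq_or_eq_of_isLink_of_isLink h.1 h'.1
        left_mem_of_isLink := by
          rintro x a b ⟨-, p, -, -, ⟨rfl, -⟩ | ⟨-, rfl⟩⟩ <;> exact Set.mem_range_self _ }
    have hne : ∀ {x a b}, R x a b → a ≠ b := by
      rintro x a b ⟨-, p, hp, -, h⟩ rfl
      have := hf (mem_orderedEdges.1 hp).1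
      rcases h with ⟨h₁, h₂⟩ | ⟨h₁, h₂⟩ <;> exact this.ne (h₁.symm.trans h₂)
    have hadj : ∀ i j, (∃ x, R x (f i) (f j)) ↔ H.Adj (π.symm i) (π.symm j) := by
      intro i j
      rw [mem_orderedEdges_or_swap]
      constructor
      · rintro ⟨x, -, p, hp, -, ⟨h₁, h₂⟩ | ⟨h₁, h₂⟩⟩
        · rw [hf.injective h₁, hf.injective h₂]
          exact .inl hp
        · rw [hf.injective h₁, hf.injective h₂]
          exact .inr hp
      · rintro (h | h)
        · obtain ⟨t, ht⟩ := hG _ h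
          exact ⟨_, ht, _, h, rfl, .inl ⟨rfl, rfl⟩⟩
        · obtain ⟨t, ht⟩ := hG _ h
          exact ⟨_, ht.symm, _, h, rfl, .inr ⟨rfl, rfl⟩⟩
    let F : V → S.vertexSet := fun v => ⟨f (π v), π v, rfl⟩
    have hF : Function.Bijective F := by
      constructor
      · intro u v h
        exact π.injective (hf.injective (congrArg Subtype.val h))
      · rintro ⟨a, i, hi⟩
        exact ⟨π.symm i, Subtype.ext (by simpa [F] using hi)⟩
    refine ⟨S, ⟨⟨?_, fun x a b h => h.1⟩, ?_, ⟨Equiv.ofBijective F hF, ?_⟩,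
      fun u v h => hf h⟩, rfl⟩
    · exact fun a _ => trivial
    · refine @Graph.Simple.mk _ _ S ⟨fun x a h => hne h rfl⟩ ?_
      intro x y a b hx hy
      have hlt : ∀ {x y a b}, a < b → R x a b → R y a b → x = y := by
        have hR : ∀ {x a b}, a < b → R x a b → (b : ℕ) = x.1 + 1 ∧
            ∃ p, x.2 = ℓ p ∧ a = f p.1 ∧ b = f p.2 := by
          rintro x a b hab ⟨h, p, hp, hx, hab' | ⟨rfl, rfl⟩⟩
          · exact ⟨((State.isLink_iff_of_lt hab).1 h).1, p, hx, hab'⟩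
          · exact absurd hab (lt_asymm (hf (mem_orderedEdges.1 hp).1))
        intro x y a b hab hx hy
        obtain ⟨h₁, p, h₂, h₃, h₄⟩ := hR hab hx
        obtain ⟨h₁', p', h₂', h₃', h₄'⟩ := hR hab hy
        have hp : p = p' :=
          Prod.ext (hf.injective (h₃.symm.trans h₃')) (hf.injective (h₄.symm.trans h₄'))
        exact Prod.ext (Fin.ext (by omega)) (by rw [h₂, h₂', hp])
      rcases lt_or_gt_of_ne (hne hx) with hab | hab
      · exact hlt hab hx hy
      · exact hlt hab (Graph.IsLink.symm (G := S) hx) (Graph.IsLink.symm (G := S) hy)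
    · intro u v
      have := hadj (π u) (π v)
      simp only [Equiv.symm_apply_apply] at this
      rw [← this]
      exact ⟨fun h => h.2, fun ⟨x, hx⟩ => ⟨fun h => hne hx (congrArg Subtype.val h), x, hx⟩⟩
  rw [copies, ← Set.ncard_coe_finset]
  choose! F hF hFv using key
  have := finite_graph (Fin (n + 1)) (Fin n × Fin m)
  refine Set.ncard_le_ncard_of_injOn F hF (fun f hf g hg h => ?_) (Set.toFinite _)
  refine ((mem_filter.1 hf).2.1.range_inj (mem_filter.1 hg).2.1).1 ?_
  rw [← hFv f hf, ← hFv g hg, h]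

end CountingMaps

end PrefAttach

namespace PrefAttach

open Finset

/-! ### The expected number of copies of a cycle -/

section Expectation

variable {V : Type*} {k m n : ℕ} {H : SimpleGraph V} {π : V ≃ Fin k} {δ : ℝ}

theorem target_le_step {f : Fin k → Fin (n + 1)} (hf : StrictMono f) (ℓ : Fin k × Fin k → Fin m) :
    ∀ r ∈ required m H π f ℓ, r.2.2 ≤ r.1 := by
  simp only [required, forall_mem_image]
  intro p hp
  have := Fin.lt_def.1 (hf (mem_orderedEdges.1 hp).1)
  omega

theorem step_lt {f : Fin k → Fin (n + 1)} (hf : StrictMono f) (ℓ : Fin k × Fin k → Fin m) :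
    ∀ r ∈ required m H π f ℓ, r.1 < n := by
  simp only [required, forall_mem_image]
  intro p hp
  have := Fin.lt_def.1 (hf (mem_orderedEdges.1 hp).1)
  omega

/-- Regrouping by vertices: a vertex is the older end of `inDeg` edges and the younger end of
`outDeg` edges. -/
theorem prod_orderedEdges_rpow (m : ℕ) (δ : ℝ) {y : Fin k → ℝ} (hy : ∀ i, 0 < y i) :
    ∏ p ∈ orderedEdges H π,
        (y p.1 ^ (-(1 / (tau m δ - 1))) * y p.2 ^ (-(1 - 1 / (tau m δ - 1)))) =
      ∏ i, y i ^ (-vertexExponent m δ H π i) := by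
  rw [prod_mul_distrib]
  have h1 := prod_fiberwise (orderedEdges H π) Prod.fst
    fun p => y p.1 ^ (-(1 / (tau m δ - 1)))
  have h2 := prod_fiberwise (orderedEdges H π) Prod.snd
    fun p => y p.2 ^ (-(1 - 1 / (tau m δ - 1)))
  rw [← h1, ← h2, ← prod_mul_distrib]
  refine prod_congr rfl fun i _ => ?_
  rw [prod_congr rfl fun p hp => by rw [(mem_filter.1 hp).2], prod_const, ← inDeg_eq_card,
    prod_congr rfl fun p hp => by rw [(mem_filter.1 hp).2], prod_const, ← outDeg_eq_card,
    ← Real.rpow_natCast, ← Real.rpow_natCast, ← Real.rpow_mul (hy i).le,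
    ← Real.rpow_mul (hy i).le, ← Real.rpow_add (hy i), vertexExponent]
  congr 1
  ring

open Classical in
/-- An upper bound for the probability that a given increasing map yields a copy of `H`. -/
theorem exists_expect_meets_required_le (hm : 0 < m) (hδ : 0 < δ) (H : SimpleGraph V)
    (π : V ≃ Fin k) : ∃ C : ℝ, 0 ≤ C ∧
    ∀ (n : ℕ) (f : Fin k → Fin (n + 1)) (ℓ : Fin k × Fin k → Fin m), StrictMono f →
      expect m δ hδ n (fun G => if G.Meets (required m H π f ℓ) then 1 else 0) ≤
        C * ∏ i, ((f i : ℝ) + 1) ^ (-vertexExponent m δ H π i) := by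
  obtain ⟨C, hC, h⟩ := exists_edgeBound_le hm hδ
  refine ⟨∏ p ∈ orderedEdges H π, ((m + δ + #(orderedEdges H π)) * C), by positivity,
    fun n f ℓ hf => ?_⟩
  refine (expect_meets_le (target_le_step hf ℓ) hδ n (step_lt hf ℓ)).trans ?_
  have hcard : #(required m H π f ℓ) = #(orderedEdges H π) := card_image_of_injOn (required_injOn hf)
  rw [hcard, ← prod_orderedEdges_rpow m δ fun i => by positivity, ← prod_mul_distrib, required,
    prod_image (required_injOn hf)]
  refine prod_le_prod (fun p _ => ?_) fun p hp => ?_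
  · have hL := totalWeight_pos hδ m
    refine mul_nonneg (by positivity) (mul_nonneg (one_div_nonneg.2 (hL _).le) ?_)
    exact prod_nonneg fun t _ => by have := hL t; positivity
  · have hlt := Fin.lt_def.1 (hf (mem_orderedEdges.1 hp).1)
    -- The edges from vertex `f p.2` to older vertices are drawn in step `f p.2 - 1`.
    have := h (f p.1) ((f p.2 : ℕ) - 1) (by omega)
    rw [Nat.sub_add_cancel (by omega)] at this
    rw [mul_assoc]
    exact mul_le_mul_of_nonneg_left this (by positivity)

/-- The probability bound does not depend on the labels, so they cost only the number of labellings,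
and the sum over maps is logarithmic. -/
theorem exists_expect_card_labelledMaps_le (hm : 0 < m) (hδ : 0 < δ) (hk : 0 < k)
    (hH : ∀ v, (H.neighborSet v).ncard = 2) (hc : H.Connected) :
    ∃ C : ℝ, 0 ≤ C ∧ ∀ n : ℕ, expect m δ hδ n (fun G => (#(labelledMaps H π G) : ℝ)) ≤
      C * (1 + Real.log (n + 1)) := by
  classical
  obtain ⟨C₁, hC₁, h₁⟩ := exists_expect_meets_required_le hm hδ H π
  obtain ⟨C₂, hC₂, h₂⟩ := exists_sum_strictMono_le hk (vertexExponent m δ H π)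
    (sum_vertexExponent m δ hH) fun s hs => by
      simpa only [Fin.le_def] using lt_sum_vertexExponent_tail hm hδ hH hc hs s.isLt
  refine ⟨Fintype.card (Fin k × Fin k → Fin m) * C₁ * C₂, by positivity, fun n => ?_⟩
  simp only [card_labelledMaps]
  rw [expect_sum]
  simp only [expect_sum]
  calc _ ≤ ∑ f : Fin k → Fin (n + 1) with StrictMono f, ∑ _ℓ : Fin k × Fin k → Fin m,
        C₁ * ∏ i, ((f i : ℝ) + 1) ^ (-vertexExponent m δ H π i) :=
        sum_le_sum fun f hf => sum_le_sum fun ℓ _ => h₁ n f ℓ (mem_filter.1 hf).2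
    _ = Fintype.card (Fin k × Fin k → Fin m) * C₁ *
        ∑ f : Fin k → Fin (n + 1) with StrictMono f,
          ∏ i, ((f i : ℝ) + 1) ^ (-vertexExponent m δ H π i) := by
        simp only [sum_const, card_univ, nsmul_eq_mul, mul_sum, mul_assoc]
    _ ≤ _ := by
        rw [mul_assoc _ C₂]
        have := h₂ (n + 1)
        push_cast at this
        gcongr

open Classical in
/-- A labelling of the edges that is injective on the at most two edges to older vertices. -/
noncomputable def twoLabels (hm : 2 ≤ m) (H : SimpleGraph V) (π : V ≃ Fin k)
    (p : Fin k × Fin k) : Fin m :=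
  if ∃ a < p.1, (a, p.2) ∈ orderedEdges H π then ⟨1, by omega⟩ else ⟨0, by omega⟩

/-- If p.1 < q.1 and the labels agree, then `q` has label 1, hence so does `p`. This produces a
third, still older neighbour of the same vertex, against degree two. -/
theorem twoLabels_injOn (hm : 2 ≤ m) (hH : ∀ v, (H.neighborSet v).ncard = 2)
    {p q : Fin k × Fin k} (hp : p ∈ orderedEdges H π) (hq : q ∈ orderedEdges H π)
    (h₂ : p.2 = q.2) (h : twoLabels hm H π p = twoLabels hm H π q) : p = q := by
  have key : ∀ p q : Fin k × Fin k, p ∈ orderedEdges H π → q ∈ orderedEdges H π →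
      p.2 = q.2 → twoLabels hm H π p = twoLabels hm H π q → ¬ p.1 < q.1 := by
    intro p q hp hq h₂ h hlt
    have hq1 : ∃ a < q.1, (a, q.2) ∈ orderedEdges H π := ⟨p.1, hlt, by rwa [← h₂]⟩
    have hp1 : ∃ a < p.1, (a, p.2) ∈ orderedEdges H π := by
      by_contra hp1
      rw [twoLabels, twoLabels, if_neg hp1, if_pos hq1] at h
      simp at h
    obtain ⟨a, ha, hap⟩ := hp1
    have hle : outDeg H π (π.symm p.2) ≤ 2 := by
      rw [← hH (π.symm p.2), ← inDeg_add_outDeg (π := π)]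
      exact Nat.le_add_left _ _
    rw [outDeg_eq_card] at hle
    have hsub : ({(a, p.2), p, q} : Finset (Fin k × Fin k)) ⊆
        {r ∈ orderedEdges H π | r.2 = p.2} := by
      intro r hr
      simp only [mem_insert, mem_singleton] at hr
      rcases hr with rfl | rfl | rfl
      · exact mem_filter.2 ⟨hap, rfl⟩
      · exact mem_filter.2 ⟨hp, rfl⟩
      · exact mem_filter.2 ⟨hq, h₂.symm⟩
    have hcard : #({(a, p.2), p, q} : Finset (Fin k × Fin k)) = 3 := by
      refine card_eq_three.2 ⟨_, _, _, ?_, ?_, ?_, rfl⟩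
      · exact fun e => ha.ne (congrArg Prod.fst e)
      · exact fun e => (ha.trans hlt).ne (congrArg Prod.fst e)
      · exact fun e => hlt.ne (congrArg Prod.fst e)
    have := card_le_card hsub
    omega
  refine Prod.ext (le_antisymm ?_ ?_) h₂
  · exact not_lt.1 (key q p hq hp h₂.symm h.symm)
  · exact not_lt.1 (key p q hp hq h₂ h)

/-- No single draw is asked to take two values, so the prescribed edges are compatible, as
`le_expect_meets` requires. -/
theorem card_targets_le_one (hm : 2 ≤ m) (hH : ∀ v, (H.neighborSet v).ncard = 2)
    {f : Fin k → Fin (n + 1)} (hf : StrictMono f) (t : ℕ) (j : Fin m) :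
    #(targets (required m H π f (twoLabels hm H π)) t j) ≤ 1 := by
  rw [card_le_one]
  intro a ha b hb
  simp only [targets, required, mem_filter, mem_univ, true_and, mem_image, Prod.mk.injEq] at ha hb
  obtain ⟨p, hp, hp₁, hp₂, hp₃⟩ := ha
  obtain ⟨q, hq, hq₁, hq₂, hq₃⟩ := hb
  have h₁ := Fin.lt_def.1 (hf (mem_orderedEdges.1 hp).1)
  have h₂ := Fin.lt_def.1 (hf (mem_orderedEdges.1 hq).1)
  have hpq := twoLabels_injOn hm hH hp hq (hf.injective (Fin.ext (by omega))) (hp₂.trans hq₂.symm)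
  exact Fin.ext (by rw [← hp₃, ← hq₃, hpq])

open Classical in
-- All `k` edges are drawn before the youngest vertex `f v` is complete, when the total weight is at
-- most (2m + δ)(f v + 1).
theorem le_expect_meets_required (hm : 2 ≤ m) (hδ : 0 < δ)
    (hH : ∀ v, (H.neighborSet v).ncard = 2) {f : Fin k → Fin (n + 1)} (hf : StrictMono f)
    {v : Fin k} (hv : ∀ i, i ≤ v) :
    (δ / (2 * m + δ) * (1 / ((f v : ℝ) + 1))) ^ k ≤
      expect m δ hδ n
        (fun G => if G.Meets (required m H π f (twoLabels hm H π)) then 1 else 0) := by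
  refine le_trans ?_ (le_expect_meets (target_le_step hf _) hδ (card_targets_le_one hm hH hf) n)
  rw [filter_true_of_mem (step_lt hf _), required, prod_image (required_injOn hf)]
  have hpow : ∀ x : ℝ, x ^ k = ∏ _p ∈ orderedEdges H π, x := fun x => by
    rw [prod_const, card_orderedEdges hH]
  rw [hpow]
  refine prod_le_prod (fun _ _ => by positivity) fun p hp => ?_
  have h₁ := Fin.lt_def.1 (hf (mem_orderedEdges.1 hp).1)
  have h₂ := Fin.le_def.1 (hf.monotone (hv p.2))
  have h₃ : (((f p.2 : ℕ) - 1 : ℕ) : ℝ) + 1 ≤ (f v : ℝ) := by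
    have : (f p.2 : ℕ) - 1 + 1 ≤ (f v : ℕ) := by omega
    exact_mod_cast this
  rw [div_mul_div_comm, mul_one, totalWeight]
  refine div_le_div_of_nonneg_left hδ.le ?_ ?_
  · positivity
  · have := mul_le_mul_of_nonneg_left h₃ (by positivity : (0 : ℝ) ≤ 2 * m + δ)
    have hm' : (0 : ℝ) ≤ m := m.cast_nonneg
    nlinarith

theorem exists_le_expect_card_embeddings (hm : 2 ≤ m) (hδ : 0 < δ) (hk : 0 < k)
    (hH : ∀ v, (H.neighborSet v).ncard = 2) :
    ∃ c : ℝ, 0 < c ∧ ∀ᶠ n : ℕ in Filter.atTop, c * Real.log n ≤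
      expect m δ hδ n fun G => (#(embeddings H π (twoLabels hm H π) G) : ℝ) := by
  classical
  obtain ⟨k, rfl⟩ := Nat.exists_eq_succ_of_ne_zero hk.ne'
  obtain ⟨c, hc, h⟩ := exists_le_sum_strictMono k
  have hm' : (0 : ℝ) < m := by exact_mod_cast (by omega : 0 < m)
  set q : ℝ := δ / (2 * m + δ) with hq
  have hq0 : 0 < q := by positivity
  refine ⟨q ^ (k + 1) * c, by positivity, ?_⟩
  filter_upwards [(Filter.tendsto_add_atTop_nat 1).eventually h,
    Filter.eventually_gt_atTop 0] with n hn hn0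
  simp only [card_embeddings]
  rw [expect_sum]
  calc q ^ (k + 1) * c * Real.log n ≤ q ^ (k + 1) * (c * Real.log (n + 1 : ℕ)) := by
        rw [mul_assoc]
        have : Real.log n ≤ Real.log (n + 1 : ℕ) :=
          Real.log_le_log (by exact_mod_cast hn0) (by exact_mod_cast n.le_succ)
        gcongr
    _ ≤ q ^ (k + 1) * ∑ f : Fin (k + 1) → Fin (n + 1) with StrictMono f,
        (1 / ((f (Fin.last k) : ℝ) + 1)) ^ (k + 1) := by gcongr
    _ ≤ _ := by
        rw [mul_sum]
        refine sum_le_sum fun f hf => ?_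
        rw [← mul_pow]
        exact le_expect_meets_required hm hδ hH (mem_filter.1 hf).2 Fin.le_last

end Expectation

end PrefAttach

/-! ### The theorem for cycles -/

theorem mainTheorem3 {V : Type*} (m : ℕ) (hm : 2 ≤ m) (δ : ℝ) (hδ : 0 < δ)
    (k : ℕ) (hk : 3 ≤ k) (H : SimpleGraph V) (hH : Nonempty (H ≃g SimpleGraph.cycleGraph k))
    (π : V ≃ Fin k) :
    (PrefAttach.B m δ H π = -(k : ℝ) ∧
      PrefAttach.optimizers m δ H π = {0, k} ∧
      PrefAttach.r m δ H π = 2) ∧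
    ∃ C₃ C₄ : ℝ, 0 < C₃ ∧ C₃ ≤ C₄ ∧ ∀ᶠ n : ℕ in Filter.atTop,
      (C₃ * Real.log n ≤
          PrefAttach.expect m δ hδ n (fun G => (PrefAttach.copies H π G : ℝ)) ∧
        PrefAttach.expect m δ hδ n (fun G => (PrefAttach.copies H π G : ℝ)) ≤
          C₄ * Real.log n) ∧
      (C₃ * Real.log n ≤
          PrefAttach.expect m δ hδ n (fun G => (PrefAttach.simpleCopies H π G : ℝ)) ∧
        PrefAttach.expect m δ hδ n (fun G => (PrefAttach.simpleCopies H π G : ℝ)) ≤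
          C₄ * Real.log n) := by
  obtain ⟨e⟩ := hH
  have hd := PrefAttach.ncard_neighborSet_of_iso_cycleGraph hk e
  have hc := PrefAttach.connected_of_iso_cycleGraph hk e
  have hm0 : 0 < m := by omega
  have hk0 : 0 < k := by omega
  have hopt : PrefAttach.optimizers m δ H π = {0, k} := PrefAttach.optimizers_eq hm0 hδ hd hc
  refine ⟨⟨PrefAttach.B_eq hm0 hδ hd hc, hopt, ?_⟩, ?_⟩
  · rw [PrefAttach.r, hopt, Finset.card_pair hk0.ne]
  obtain ⟨C₃, hC₃, h₃⟩ := PrefAttach.exists_le_expect_card_embeddings (π := π) hm hδ hk0 hd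
  obtain ⟨C, hC, h⟩ := PrefAttach.exists_expect_card_labelledMaps_le (π := π) hm0 hδ hk0 hd hc
  have hlog : Filter.Tendsto (fun n : ℕ => Real.log n) Filter.atTop Filter.atTop :=
    Real.tendsto_log_atTop.comp tendsto_natCast_atTop_atTop
  -- The 3 comes from 1 ≤ log n and log(n + 1) ≤ 2 log n; adding `C₃` guarantees C₃ ≤ C₄.
  have h₄ : ∀ᶠ n : ℕ in Filter.atTop, C * (1 + Real.log (n + 1)) ≤ (C * 3 + C₃) * Real.log n := by
    filter_upwards [hlog.eventually_ge_atTop 1, Filter.eventually_ge_atTop 2] with n hn hn2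
    have hn2' : (2 : ℝ) ≤ n := by exact_mod_cast hn2
    have h1 : Real.log (n + 1) ≤ 2 * Real.log n := by
      rw [← Real.log_rpow (by linarith)]
      refine Real.log_le_log (by linarith) ?_
      rw [Real.rpow_two]
      nlinarith
    have h2 : C * (1 + Real.log (n + 1)) ≤ C * (3 * Real.log n) := by
      gcongr
      linarith
    nlinarith
  refine ⟨C₃, C * 3 + C₃, hC₃, by linarith, ?_⟩
  filter_upwards [h₃, h₄] with n hn hn'
  refine ⟨⟨hn.trans ?_, le_trans ?_ ((h n).trans hn')⟩, hn.trans ?_, le_trans ?_ ((h n).trans hn')⟩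
  · exact PrefAttach.expect_mono hδ fun G =>
      Nat.cast_le.2 (PrefAttach.card_embeddings_le_copies G)
  · exact PrefAttach.expect_mono hδ fun G =>
      Nat.cast_le.2 (PrefAttach.copies_le_card_labelledMaps hm0 G)
  · exact PrefAttach.expect_mono hδ fun G =>
      Nat.cast_le.2 (PrefAttach.card_embeddings_le_simpleCopies G)
  · exact PrefAttach.expect_mono hδ fun G =>
      Nat.cast_le.2 (PrefAttach.simpleCopies_le_card_labelledMaps hm0 G)
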